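/- **Setting.** Let $\ell>0$, $\mu>0$, $\tau_{\rm buoy}\ge 0$, $\delta_0\in\mathbb R$, $\kappa=\sqrt{\mu/3}$, and let $h_{\rm eq}:[0,\ell]\to(0,1]$ be such that $x^2/h_{\rm eq}$ is integrable on $(0,\ell)$. For $m\ge 0$ set $$\tau_m^2=\tau_{\rm buoy}^2+\frac1\ell\int_0^\ell\frac{x^2}{h_{\rm eq}(x)}\,dx+\frac{m}{3}\,\frac{1}{h_{\rm eq}(\ell)},$$ so that $\tau_\mu^2$ and $\tau_0^2$ are its values at $m=\mu$ and $m=0$. Let $\mathcal K^1_\mu(t)=\frac1t J_1(t/\kappa)$, where $J_1(t)=\frac1\pi\int_0^\pi\cos(\theta-t\sin\theta)\,d\theta$ is the Bessel function, and write $f*g(t)=\int_0^t f(t-s)g(s)\,ds$. Consider on $\mathbb R^+=[0,\infty)$ the linear dispersive Cummins equation $$(\tau_\mu^2+\ell\kappa)\,\ddot\delta+\ell\,\mathcal K^1_\mu*\dot\delta+\delta=0,\qquad \delta(0)=\delta_0,\quad \dot\delta(0)=0. \tag{1}$$ **Proposition.** 1. There is a unique solution $\delta\in C^2(\mathbb R^+)\cap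 W^{1,\infty}(\mathbb R^+)$ of (1). 2. Moreover $\delta\in H^2(\mathbb R^+)$; but if $\delta_0\neq0$, then $t\,\delta^{(k)}\notin L^2(\mathbb R^+)$ for $k\in\{0,1,2\}$. 3. If $\delta_0\ne0$, then for all $\alpha>0$, $k\in\{0,1,2\}$, $c>0$ and $T_0>0$ there exists $t>T_0$ such that $|\delta^{(k)}(t)|>c\,t^{-\frac32-\alpha}$. 4. Consequently the return to equilibrium is slower than in the non-dispersive case: if $\delta_0\neq 0$, then for all $r>0$, $k\in\{0,1,2\}$, $c>0$ and $T_0>0$ there is $t>T_0$ with $|\delta^{(k)}(t)|>c\,e^{-rt}$, whereas the non-dispersive equation $\tau_0^2\ddot\eta+\ell\dot\eta+\eta=0$, $\eta(0)=\delta_0$, $\dot\eta(0)=0$, has a unique solution $\eta\in C^2(\mathbb R^+)$, and there are $r,C>0$ with $|\eta^{(k)}(t)|\le C e^{-rt}$ for all $t\ge0$ and $k\in\{0,1,2\}$. -/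

import Mathlib

open MeasureTheory Set
open scoped ENNReal ContDiff

noncomputable section

namespace Cummins

/-- `g` is the weak (distributional) derivative of order `k` of `f` on the open set `Ω`. -/
def IsWeakDerivOn (k : ℕ) (Ω : Set ℝ) (f g : ℝ → ℝ) : Prop :=
  LocallyIntegrableOn f Ω volume ∧ LocallyIntegrableOn g Ω volume ∧
    ∀ φ : ℝ → ℝ, ContDiff ℝ ∞ φ → HasCompactSupport φ → tsupport φ ⊆ Ω →
      ∫ x in Ω, f x * iteratedDeriv k φ x = (-1) ^ k * ∫ x in Ω, g x * φ x

/-- The Sobolev space `W^{m,p}(Ω)`, for `Ω` an open subset of the line: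
all weak derivatives of order `0, …, m` exist and are in `L^p(Ω)`. -/
def MemSobolev (m : ℕ) (p : ℝ≥0∞) (Ω : Set ℝ) (f : ℝ → ℝ) : Prop :=
  ∀ k ≤ m, ∃ g : ℝ → ℝ, IsWeakDerivOn k Ω f g ∧ MemLp g p (volume.restrict Ω)

/-- The classical derivative `f^{(k)}` of a function of time `t ∈ [0, ∞)`
(one-sided at `t = 0`). -/
def timeDeriv (k : ℕ) (f : ℝ → ℝ) : ℝ → ℝ :=
  iteratedDerivWithin k f (Ici 0)

/-- The Bessel function `J_n(t) = (1/π) ∫_0^π cos (n θ - t sin θ) dθ`. -/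
def besselJ (n : ℕ) (t : ℝ) : ℝ :=
  (1 / Real.pi) * ∫ θ in (0 : ℝ)..Real.pi, Real.cos (n * θ - t * Real.sin θ)

/-- The dispersion parameter `κ = √(μ/3)`. -/
def kappa (μ : ℝ) : ℝ := Real.sqrt (μ / 3)

/-- The causal kernel `K¹_μ(t) = J_1(t/κ)/t`. Its value at the single point `t = 0`
(where the formula is meant by continuity) is irrelevant: it is only used in convolutions. -/
def kernelK1 (μ t : ℝ) : ℝ := besselJ 1 (t / kappa μ) / t

/-- Convolution of causal functions, `(f * g)(t) = ∫_0^t f(t-s) g(s) ds`. -/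
def causalConv (f g : ℝ → ℝ) (t : ℝ) : ℝ := ∫ s in (0 : ℝ)..t, f (t - s) * g s

/-- `τ_μ² = τ_buoy² + (1/ℓ) ∫_0^ℓ x²/h_eq(x) dx + κ²/h_eq(ℓ)`. -/
def tauSq (τbuoy ℓ : ℝ) (heq : ℝ → ℝ) (μ : ℝ) : ℝ :=
  τbuoy ^ 2 + (1 / ℓ) * (∫ x in (0 : ℝ)..ℓ, x ^ 2 / heq x) + kappa μ ^ 2 / heq ℓ

/-- `δ ∈ C²(ℝ⁺)` solves the linear dispersive Cummins equation
`(τ_μ² + ℓ κ) δ'' + ℓ K¹_μ * δ' + δ = 0` with `δ(0) = δ₀`, `δ'(0) = 0`. -/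
def IsDispersiveSolution (τbuoy ℓ : ℝ) (heq : ℝ → ℝ) (μ δ₀ : ℝ) (δ : ℝ → ℝ) : Prop :=
  ContDiffOn ℝ 2 δ (Ici 0) ∧
  (∀ t, 0 ≤ t →
    (tauSq τbuoy ℓ heq μ + ℓ * kappa μ) * timeDeriv 2 δ t
      + ℓ * causalConv (kernelK1 μ) (timeDeriv 1 δ) t + δ t = 0) ∧
  δ 0 = δ₀ ∧ timeDeriv 1 δ 0 = 0

/-- `η ∈ C²(ℝ⁺)` solves the linear non dispersive (`μ = 0`) equation
`τ_0² η'' + ℓ η' + η = 0` with `η(0) = δ₀`, `η'(0) = 0`. -/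
def IsNonDispersiveSolution (τbuoy ℓ : ℝ) (heq : ℝ → ℝ) (δ₀ : ℝ) (η : ℝ → ℝ) : Prop :=
  ContDiffOn ℝ 2 η (Ici 0) ∧
  (∀ t, 0 ≤ t → tauSq τbuoy ℓ heq 0 * timeDeriv 2 η t + ℓ * timeDeriv 1 η t + η t = 0) ∧
  η 0 = δ₀ ∧ timeDeriv 1 η 0 = 0

end Cummins

end

section

open Complex Filter Topology Metric

namespace Cummins

/-! Put ν = 1/κ and parametrise the right half-plane by the unit disc through s = ν(1/ζ - ζ)/2. In
this coordinate the Laplace transform of J₁(νt)/t is ζ itself, so the transforms of δ, δ', δ''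
become rational functions of ζ with common denominator `symbolPoly`. Since τ_μ² > κ², that
denominator has no zero in the closed disc (`symbolPoly_ne_zero`).

The inverse transform is explicit: `discTransform` integrates H over the unit circle against ν cos θ
exp(-iνt sin θ), and Cauchy's formula gives it the Laplace transform H(ζ) (`laplace_discTransform`).
It turns multiplication by s into d/dt and multiplication by ζ into convolution with the kernel
(`hasDerivAt_discTransform`, `conv_discTransform`), so the solution is written down and checked in
the variable ζ (`exists_dispersive`). Integration by parts in θ bounds t δ⁽ᵏ⁾(t), whence δ ∈ H².

The slow decay comes from the branch point s = iν, that is ζ = -i, where ζ + i has size √ε at s = ε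
+ iν. The transform of t δ⁽ᵏ⁾ contains 1/(1 + ζ²), hence grows like ε^(-1/2) when H'(-i) ≠ 0,
whereas the transform of a bounded L² function is o(ε^(-1/2)) (`sqrt_mul_laplace_tendsto_zero`,
`not_memLp_mul_discTransform`). A rate t^(-3/2-α), and a fortiori an exponential one, would put t
δ⁽ᵏ⁾ in L².

Uniqueness is Grönwall's inequality (`eq_zero_of_timeDeriv_two_le`). The non-dispersive equation is
a damped oscillator whose characteristic roots have negative real part. -/

/-! ### Oscillatory integrals and the Laplace transform. -/

/-- `(1/2π) ∫_0^{2π} exp(-i ν t sin θ) g(θ) dθ`. -/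
noncomputable def spectralInt (ν : ℝ) (g : ℝ → ℂ) (t : ℝ) : ℂ :=
  (1 / (2 * Real.pi)) * ∫ θ in (0 : ℝ)..2 * Real.pi, cexp (-I * ν * t * Real.sin θ) * g θ

lemma norm_cexp_neg_I_mul (ν t θ : ℝ) : ‖cexp (-I * ν * t * Real.sin θ)‖ = 1 := by
  rw [show -I * ν * t * Real.sin θ = ((-(ν * t * Real.sin θ) : ℝ) : ℂ) * I by push_cast; ring]
  exact norm_exp_ofReal_mul_I _

lemma spectralInt_bounded (ν : ℝ) (g : ℝ → ℂ) :
    ∃ C, ∀ t, ‖spectralInt ν g t‖ ≤ C := by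
  refine ⟨‖(1 / (2 * Real.pi) : ℂ)‖ * ∫ θ in (0 : ℝ)..2 * Real.pi, ‖g θ‖, fun t => ?_⟩
  rw [spectralInt, norm_mul]
  gcongr
  refine (intervalIntegral.norm_integral_le_integral_norm (by positivity)).trans_eq ?_
  simp only [norm_mul, norm_cexp_neg_I_mul, one_mul]

lemma hasDerivAt_spectralInt (ν : ℝ) {g : ℝ → ℂ} (hg : Continuous g) (t : ℝ) :
    HasDerivAt (spectralInt ν g) (spectralInt ν (fun θ => -I * ν * Real.sin θ * g θ) t) t := by
  unfold spectralInt
  refine HasDerivAt.const_mul _ ?_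
  have := intervalIntegral.hasDerivAt_integral_of_dominated_loc_of_deriv_le (μ := volume)
    (F := fun (t : ℝ) θ => cexp (-I * ν * t * Real.sin θ) * g θ)
    (F' := fun (t : ℝ) θ => cexp (-I * ν * t * Real.sin θ) * (-I * ν * Real.sin θ * g θ))
    (bound := fun θ => ‖-I * ν * Real.sin θ * g θ‖) (a := 0) (b := 2 * Real.pi) (x₀ := t)
    (s := univ) univ_mem ?_ ?_ ?_ ?_ ?_ ?_
  · exact this.2
  · exact Eventually.of_forall fun t => Continuous.aestronglyMeasurable (by fun_prop)
  · exact Continuous.intervalIntegrable (by fun_prop) _ _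
  · exact Continuous.aestronglyMeasurable (by fun_prop)
  · refine ae_of_all _ fun θ _ t _ => ?_
    rw [norm_mul, norm_cexp_neg_I_mul, one_mul]
  · exact Continuous.intervalIntegrable (by fun_prop) _ _
  · refine ae_of_all _ fun θ _ t _ => ?_
    have h1 : HasDerivAt (fun t : ℝ => -I * ν * t * Real.sin θ) (-I * ν * Real.sin θ) t := by
      have := ((hasDerivAt_id t).ofReal_comp.const_mul (-I * (ν : ℂ))).mul_const (Real.sin θ : ℂ)
      simpa using this
    convert! (h1.cexp.mul_const (g θ)) using 1
    ring

lemma continuous_spectralInt (ν : ℝ) {g : ℝ → ℂ} (hg : Continuous g) :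
    Continuous (spectralInt ν g) :=
  continuous_iff_continuousAt.2 fun t => (hasDerivAt_spectralInt ν hg t).continuousAt

lemma integrableOn_cexp_neg_mul {s : ℂ} (hs : 0 < s.re) :
    IntegrableOn (fun t : ℝ => cexp (-s * t)) (Ioi 0) :=
  integrableOn_exp_mul_complex_Ioi (by simpa using hs) 0

lemma integrableOn_cexp_mul_of_bounded {s : ℂ} (hs : 0 < s.re) {f : ℝ → ℂ} (hf : Continuous f)
    (hb : ∃ C, ∀ t, ‖f t‖ ≤ C) : IntegrableOn (fun t : ℝ => cexp (-s * t) * f t) (Ioi 0) := by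
  obtain ⟨C, hC⟩ := hb
  exact Integrable.mul_bdd (c := C) (integrableOn_cexp_neg_mul hs) hf.aestronglyMeasurable (ae_of_all _ hC)

/-- The Laplace transform of a spectral integral. -/
lemma laplace_spectralInt (ν : ℝ) {g : ℝ → ℂ} (hg : Continuous g) {s : ℂ} (hs : 0 < s.re) :
    ∫ t in Ioi (0 : ℝ), cexp (-s * t) * spectralInt ν g t =
      (1 / (2 * Real.pi)) * ∫ θ in (0 : ℝ)..2 * Real.pi, g θ / (s + I * ν * Real.sin θ) := by
  have h1 : ∀ t : ℝ, cexp (-s * t) * spectralInt ν g t = (1 / (2 * Real.pi)) *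
      ∫ θ in Ioc (0 : ℝ) (2 * Real.pi),
        cexp (-s * t) * (cexp (-I * ν * t * Real.sin θ) * g θ) := by
    intro t
    rw [spectralInt, intervalIntegral.integral_of_le (by positivity),
      integral_const_mul]
    ring
  simp_rw [h1]
  rw [integral_const_mul, intervalIntegral.integral_of_le (by positivity)]
  congr 1
  rw [integral_integral_swap]
  · refine setIntegral_congr_fun measurableSet_Ioc fun θ _ => ?_
    have hre : (-(s + I * ν * Real.sin θ)).re < 0 := by
      simp only [neg_re, add_re, mul_re, I_re, I_im, ofReal_re, ofReal_im, mul_im]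
      simp; exact hs
    have := integral_exp_mul_complex_Ioi hre 0
    simp only [ofReal_zero, mul_zero, Complex.exp_zero] at this
    have h2 : ∀ t : ℝ, cexp (-s * t) * (cexp (-I * ν * t * Real.sin θ) * g θ) =
        cexp (-(s + I * ν * Real.sin θ) * t) * g θ := by
      intro t
      rw [← mul_assoc, ← Complex.exp_add]
      ring_nf
    simp only [h2]
    rw [integral_mul_const, this]
    rw [neg_div_neg_eq]; ring
  · have hb : Integrable (fun p : ℝ × ℝ => cexp (-s * p.1) * g p.2)
        ((volume.restrict (Ioi 0)).prod (volume.restrict (Ioc 0 (2 * Real.pi)))) := by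
      refine Integrable.mul_prod (integrableOn_cexp_neg_mul hs) ?_
      exact (hg.intervalIntegrable _ _).1
    refine hb.mono (Continuous.aestronglyMeasurable (by unfold Function.uncurry; fun_prop)) ?_
    refine ae_of_all _ fun p => le_of_eq ?_
    simp only [Function.uncurry, norm_mul, norm_cexp_neg_I_mul, one_mul]

/-- Integration by parts in a spectral integral. -/
lemma mul_spectralInt_eq (ν : ℝ) {g g' : ℝ → ℂ} (hg : ∀ θ, HasDerivAt g (g' θ) θ)
    (hg' : Continuous g') (hper : g (2 * Real.pi) = g 0) (t : ℝ) :
    t * spectralInt ν (fun θ => ν * Real.cos θ * g θ) t =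
      spectralInt ν (fun θ => -I * g' θ) t := by
  have hgc : Continuous g := continuous_iff_continuousAt.2 fun t => (hg t).continuousAt
  have key : ∀ θ : ℝ, HasDerivAt (fun θ : ℝ => cexp (-I * ν * t * Real.sin θ) * g θ)
      (cexp (-I * ν * t * Real.sin θ) * (-I * ν * t * Real.cos θ) * g θ +
        cexp (-I * ν * t * Real.sin θ) * g' θ) θ := fun θ =>
    ((((Real.hasDerivAt_sin θ).ofReal_comp).const_mul (-I * (ν : ℂ) * t)).cexp).mul (hg θ)
  have hint := intervalIntegral.integral_eq_sub_of_hasDerivAt (a := 0) (b := 2 * Real.pi)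
    (fun θ _ => key θ) (Continuous.intervalIntegrable (by fun_prop) _ _)
  simp only [Real.sin_two_pi, Real.sin_zero, hper, sub_self] at hint
  rw [intervalIntegral.integral_add (Continuous.intervalIntegrable (by fun_prop) _ _)
    (Continuous.intervalIntegrable (by fun_prop) _ _)] at hint
  have e1 : ∫ θ in (0 : ℝ)..2 * Real.pi,
      cexp (-I * ν * t * Real.sin θ) * (-I * ν * t * Real.cos θ) * g θ =
      -I * t * ∫ θ in (0 : ℝ)..2 * Real.pi,
        cexp (-I * ν * t * Real.sin θ) * (ν * Real.cos θ * g θ) := by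
    rw [← intervalIntegral.integral_const_mul]
    congr 1; ext θ; ring
  have e2 : ∫ θ in (0 : ℝ)..2 * Real.pi, cexp (-I * ν * t * Real.sin θ) * (-I * g' θ) =
      -I * ∫ θ in (0 : ℝ)..2 * Real.pi, cexp (-I * ν * t * Real.sin θ) * g' θ := by
    rw [← intervalIntegral.integral_const_mul]
    congr 1; ext θ; ring
  rw [spectralInt, spectralInt, e2]
  rw [e1] at hint
  linear_combination (I * (1 / (2 * Real.pi))) * hint +
    (t * (1 / (2 * Real.pi)) * ∫ θ in (0 : ℝ)..2 * Real.pi,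
        cexp (-I * ν * t * Real.sin θ) * (ν * Real.cos θ * g θ)) * I_sq

/-- A continuous function on the half-line with vanishing Laplace transform vanishes. -/
lemma eq_zero_of_laplace_eq_zero {f : ℝ → ℂ} (hf : Continuous f)
    (hint : IntegrableOn (fun t : ℝ => cexp (-(1 : ℂ) * t) * f t) (Ioi 0))
    (h0 : ∀ s : ℂ, s.re = 1 → ∫ t in Ioi (0 : ℝ), cexp (-s * t) * f t = 0) {t : ℝ} (ht : 0 < t) :
    f t = 0 := by
  -- On the line Re s = 1 the Laplace transform of f is the Fourier transform of F, so Fourier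
  -- inversion applies at every t > 0, where F is continuous.
  set F : ℝ → ℂ := (Ioi (0 : ℝ)).indicator (fun t : ℝ => cexp (-(1 : ℂ) * t) * f t) with hF
  have hFint : Integrable F := hint.integrable_indicator measurableSet_Ioi
  have hfour : FourierTransform.fourier F = fun _ => 0 := by
    ext w
    rw [Real.fourier_real_eq_integral_exp_smul, ← h0 (1 + 2 * Real.pi * w * I) (by simp),
      ← integral_indicator measurableSet_Ioi]
    congr 1; ext v
    by_cases hv : v ∈ Ioi (0 : ℝ)
    · simp only [hF, indicator_of_mem hv, smul_eq_mul, ← mul_assoc, ← Complex.exp_add]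
      congr 2; push_cast; ring
    · simp [hF, indicator_of_notMem hv]
  have hFt : F t = 0 := by
    rw [← hFint.fourierInv_fourier_eq (v := t) (by rw [hfour]; exact integrable_zero _ _ _)]
    · rw [hfour]; simp [Real.fourierInv_eq]
    · have hc : ContinuousAt (fun t : ℝ => cexp (-(1 : ℂ) * t) * f t) t :=
        Continuous.continuousAt (by fun_prop)
      refine hc.congr ?_
      filter_upwards [Ioi_mem_nhds ht] with x hx
      rw [hF, indicator_of_mem (mem_Ioi.2 hx)]
  rw [hF, indicator_of_mem (mem_Ioi.2 ht)] at hFt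
  simpa [Complex.exp_ne_zero] using hFt

/-- The Laplace transform of a causal convolution. -/
lemma laplace_conv {f g : ℝ → ℂ} (s : ℂ)
    (hf : IntegrableOn (fun t : ℝ => cexp (-s * t) * f t) (Ioi 0))
    (hg : IntegrableOn (fun t : ℝ => cexp (-s * t) * g t) (Ioi 0)) :
    IntegrableOn (fun t : ℝ => cexp (-s * t) * ∫ u in (0 : ℝ)..t, f (t - u) * g u) (Ioi 0) ∧
    ∫ t in Ioi (0 : ℝ), cexp (-s * t) * ∫ u in (0 : ℝ)..t, f (t - u) * g u =
      (∫ t in Ioi (0 : ℝ), cexp (-s * t) * f t) * ∫ t in Ioi (0 : ℝ), cexp (-s * t) * g t := by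
  -- The weight exp(-st) splits as exp(-su) exp(-s(t-u)), so the weighted convolution is the
  -- convolution of the weighted functions.
  have e : ∀ t : ℝ, cexp (-s * t) * ∫ u in (0 : ℝ)..t, f (t - u) * g u =
      ∫ u in (0 : ℝ)..t, (ContinuousLinearMap.mul ℝ ℂ) (cexp (-s * u) * g u)
        (cexp (-s * (t - u : ℝ)) * f (t - u)) := by
    intro t
    rw [← intervalIntegral.integral_const_mul]
    congr 1; ext u
    rw [show -s * (t : ℂ) = -s * u + -s * ((t - u : ℝ) : ℂ) by push_cast; ring, Complex.exp_add]
    simp only [ContinuousLinearMap.mul_apply']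
    ring
  constructor
  · have := integrable_posConvolution hg hf (ContinuousLinearMap.mul ℝ ℂ)
    rw [posConvolution, integrable_indicator_iff measurableSet_Ioi] at this
    refine this.congr_fun (fun t _ => ?_) measurableSet_Ioi
    exact (e t).symm
  · simp_rw [e]
    rw [integral_posConvolution hg hf]
    simp [mul_comm]

/-! ### The disc transform and its calculus. -/

/-- The function whose Laplace transform at `ν (1/ζ - ζ)/2` is `H ζ`, for `H` holomorphic near
the closed unit disc and vanishing at `0`. -/
noncomputable def discTransform (ν : ℝ) (H : ℂ → ℂ) (t : ℝ) : ℂ :=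
  spectralInt ν (fun θ => ν * Real.cos θ * H (cexp (θ * I))) t

lemma norm_cexp_mul_I (θ : ℝ) : ‖cexp (θ * I)‖ = 1 := norm_exp_ofReal_mul_I θ

lemma cexp_mul_I_mem (θ : ℝ) : cexp (θ * I) ∈ closedBall (0 : ℂ) 1 := by
  simp

lemma two_cexp_mul_cos (θ : ℝ) :
    2 * cexp (θ * I) * Real.cos θ = cexp (θ * I) ^ 2 + 1 := by
  rw [ofReal_cos, Complex.cos, show -(θ : ℂ) * I = -(θ * I) by ring, Complex.exp_neg]
  field_simp [Complex.exp_ne_zero]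

lemma two_cexp_mul_sin (θ : ℝ) :
    2 * cexp (θ * I) * (-I * Real.sin θ) = 1 - cexp (θ * I) ^ 2 := by
  have h : cexp (θ * I) = Real.cos θ + Real.sin θ * I := by
    rw [Complex.exp_mul_I, ofReal_cos, ofReal_sin]
  have h2 := Complex.sin_sq_add_cos_sq (θ : ℂ)
  rw [← ofReal_cos, ← ofReal_sin] at h2
  rw [h]
  linear_combination h2 - (Real.sin θ : ℂ) ^ 2 * I_sq

lemma continuous_comp_cexp {H : ℂ → ℂ} (hH : AnalyticOnNhd ℂ H (closedBall 0 1)) :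
    Continuous fun θ : ℝ => H (cexp (θ * I)) :=
  hH.continuousOn.comp_continuous (by fun_prop) cexp_mul_I_mem

lemma continuous_disc_integrand (ν : ℝ) {H : ℂ → ℂ}
    (hH : AnalyticOnNhd ℂ H (closedBall 0 1)) :
    Continuous fun θ : ℝ => (ν : ℂ) * Real.cos θ * H (cexp (θ * I)) :=
  Continuous.mul (by fun_prop) (continuous_comp_cexp hH)

lemma cauchy_circle {f : ℂ → ℂ} (hf : AnalyticOnNhd ℂ f (closedBall 0 1)) {ζ : ℂ}
    (hζ : ‖ζ‖ < 1) :
    (1 / (2 * Real.pi)) * ∫ θ in (0 : ℝ)..2 * Real.pi,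
      cexp (θ * I) / (cexp (θ * I) - ζ) * f (cexp (θ * I)) = f ζ := by
  have h := hf.differentiableOn.circleIntegral_sub_inv_smul (w := ζ) (by simpa using hζ)
  rw [circleIntegral] at h
  have e : ∀ θ : ℝ, deriv (circleMap 0 1) θ • ((circleMap 0 1 θ - ζ)⁻¹ • f (circleMap 0 1 θ)) =
      I * (cexp (θ * I) / (cexp (θ * I) - ζ) * f (cexp (θ * I))) := by
    intro θ
    simp only [deriv_circleMap, circleMap, smul_eq_mul, ofReal_one, one_mul, zero_add]
    ring
  simp_rw [e] at h
  rw [intervalIntegral.integral_const_mul] at h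
  have hpi : (Real.pi : ℂ) ≠ 0 := by exact_mod_cast Real.pi_ne_zero
  have h' : (∫ θ in (0 : ℝ)..2 * Real.pi,
      cexp (θ * I) / (cexp (θ * I) - ζ) * f (cexp (θ * I))) = 2 * Real.pi * f ζ := by
    apply mul_left_cancel₀ I_ne_zero
    rw [h, smul_eq_mul]; ring
  rw [h']
  field_simp

lemma one_add_mul_ne_zero {z ζ : ℂ} (hz : ‖z‖ ≤ 1) (hζ : ‖ζ‖ < 1) : 1 + z * ζ ≠ 0 := by
  intro h
  have h1 : ‖z * ζ‖ = 1 := by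
    rw [show z * ζ = -1 by linear_combination h]; simp
  rw [norm_mul] at h1
  nlinarith [norm_nonneg z, norm_nonneg ζ]

/-- The relation between `s` and the disc coordinate `ζ`. -/
lemma laplace_denominator {ν : ℝ} {s ζ : ℂ} (hsζ : 2 * s * ζ = ν * (1 - ζ ^ 2)) (θ : ℝ) :
    2 * cexp (θ * I) * ζ * (s + I * ν * Real.sin θ) =
      ν * ((cexp (θ * I) - ζ) * (1 + cexp (θ * I) * ζ)) := by
  linear_combination (cexp (θ * I)) * hsζ - ν * ζ * two_cexp_mul_sin θ

/-- With E = exp(iθ), the integrand equals E/(E - ζ) · f(E) for f(z) = h(z)(1 + z²)ζ/(1 + zζ), which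
is holomorphic on the closed disc because |ζ| < 1. Cauchy's formula evaluates f at ζ, where 1 + ζ²
cancels. -/
lemma laplace_discTransform {ν : ℝ} (hν : 0 < ν) {h : ℂ → ℂ}
    (hh : AnalyticOnNhd ℂ h (closedBall 0 1)) {s ζ : ℂ} (hs : 0 < s.re) (hζ : ‖ζ‖ < 1)
    (hsζ : 2 * s * ζ = ν * (1 - ζ ^ 2)) :
    ∫ t in Ioi (0 : ℝ), cexp (-s * t) * discTransform ν (fun z => z * h z) t = ζ * h ζ := by
  unfold discTransform
  rw [laplace_spectralInt ν (continuous_disc_integrand ν (analyticOnNhd_id.mul hh)) hs]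
  have hνc : (ν : ℂ) ≠ 0 := by exact_mod_cast hν.ne'
  have hζ2 : 1 + ζ * ζ ≠ 0 := one_add_mul_ne_zero hζ.le hζ
  have hζ0 : ζ ≠ 0 := by
    rintro rfl
    simp at hsζ; exact hνc hsζ.symm
  have hf : AnalyticOnNhd ℂ (fun z => h z * (1 + z * z) * ζ / (1 + z * ζ)) (closedBall 0 1) := by
    intro z hz
    refine AnalyticAt.div ?_ (by fun_prop) (one_add_mul_ne_zero (by simpa using hz) hζ)
    have := hh z hz
    fun_prop
  have hcau := cauchy_circle hf hζ
  have hval : h ζ * (1 + ζ * ζ) * ζ / (1 + ζ * ζ) = ζ * h ζ := by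
    rw [mul_right_comm, mul_div_cancel_right₀ _ hζ2, mul_comm]
  rw [hval] at hcau
  rw [← hcau]
  congr 2; ext θ
  set E := cexp (θ * I) with hE
  have hE0 : E ≠ 0 := Complex.exp_ne_zero _
  have hEζ : E - ζ ≠ 0 := by
    intro h0
    have : ‖E‖ = ‖ζ‖ := by rw [sub_eq_zero.1 h0]
    rw [hE, norm_cexp_mul_I] at this
    linarith
  have hd := laplace_denominator hsζ θ
  rw [← hE] at hd
  have h1E : 1 + E * ζ ≠ 0 := one_add_mul_ne_zero (norm_cexp_mul_I θ).le hζ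
  have hden : s + I * ν * Real.sin θ ≠ 0 := by
    intro h0
    rw [h0, mul_zero] at hd
    exact mul_ne_zero hνc (mul_ne_zero hEζ h1E) hd.symm
  have hcos := two_cexp_mul_cos θ
  rw [← hE] at hcos
  have hcos' : (Real.cos θ : ℂ) = (E ^ 2 + 1) / (2 * E) := by
    field_simp; linear_combination hcos
  have hden' : s + I * ν * Real.sin θ = ν * ((E - ζ) * (1 + E * ζ)) / (2 * E * ζ) := by
    field_simp; linear_combination hd
  rw [hden', hcos']
  field_simp
  ring

/-- `t ↦ t Φ[H](t)` is the spectral integral of `z H'(z)`. -/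
lemma mul_discTransform {ν : ℝ} {H : ℂ → ℂ} (hH : AnalyticOnNhd ℂ H (closedBall 0 1)) (t : ℝ) :
    t * discTransform ν H t =
      spectralInt ν (fun θ => cexp (θ * I) * deriv H (cexp (θ * I))) t := by
  have hc := continuous_comp_cexp hH.deriv
  unfold discTransform
  rw [mul_spectralInt_eq ν (g := fun θ => H (cexp (θ * I)))
    (g' := fun θ => deriv H (cexp (θ * I)) * (cexp (θ * I) * I)) _ (by fun_prop)]
  · congr 1; ext θ; linear_combination (-cexp (θ * I) * deriv H (cexp (θ * I))) * I_sq
  · simp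
  · intro θ
    have h1 : HasDerivAt (fun θ : ℝ => cexp (θ * I)) (cexp (θ * I) * I) θ := by
      simpa using (((hasDerivAt_id θ).ofReal_comp).mul_const I).cexp
    exact (hH _ (cexp_mul_I_mem θ)).differentiableAt.hasDerivAt.comp θ h1

/-- The right-hand side is -dH/ds written in the coordinate ζ. Its factor 1/(1 + ζ²) is the source
of the singularity at ζ = -i. -/
lemma laplace_mul_discTransform {ν : ℝ} (hν : 0 < ν) {H : ℂ → ℂ}
    (hH : AnalyticOnNhd ℂ H (closedBall 0 1)) {s ζ : ℂ} (hs : 0 < s.re) (hζ : ‖ζ‖ < 1)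
    (hsζ : 2 * s * ζ = ν * (1 - ζ ^ 2)) :
    ∫ t in Ioi (0 : ℝ), cexp (-s * t) * (t * discTransform ν H t) =
      2 * ζ ^ 2 * deriv H ζ / (ν * (1 + ζ ^ 2)) := by
  have hc := continuous_comp_cexp hH.deriv
  simp_rw [mul_discTransform hH]
  rw [laplace_spectralInt ν (by fun_prop) hs]
  have hνc : (ν : ℂ) ≠ 0 := by exact_mod_cast hν.ne'
  have hζ0 : ζ ≠ 0 := by
    rintro rfl
    simp at hsζ; exact hνc hsζ.symm
  have hf : AnalyticOnNhd ℂ (fun z => 2 * z * ζ * deriv H z / (ν * (1 + z * ζ)))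
      (closedBall 0 1) := by
    intro z hz
    have := hH.deriv z hz
    exact AnalyticAt.div (by fun_prop) (by fun_prop)
      (mul_ne_zero hνc (one_add_mul_ne_zero (by simpa using hz) hζ))
  have hcau := cauchy_circle hf hζ
  rw [show 2 * ζ ^ 2 * deriv H ζ / (ν * (1 + ζ ^ 2)) =
    2 * ζ * ζ * deriv H ζ / (ν * (1 + ζ * ζ)) by ring_nf, ← hcau]
  congr 2; ext θ
  set E := cexp (θ * I) with hE
  have hE0 : E ≠ 0 := Complex.exp_ne_zero _
  have hEζ : E - ζ ≠ 0 := by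
    intro h0
    have : ‖E‖ = ‖ζ‖ := by rw [sub_eq_zero.1 h0]
    rw [hE, norm_cexp_mul_I] at this
    linarith
  have hd := laplace_denominator hsζ θ
  rw [← hE] at hd
  have h1E : 1 + E * ζ ≠ 0 := one_add_mul_ne_zero (norm_cexp_mul_I θ).le hζ
  have hden' : s + I * ν * Real.sin θ = ν * ((E - ζ) * (1 + E * ζ)) / (2 * E * ζ) := by
    field_simp; linear_combination hd
  rw [hden']
  field_simp

lemma discTransform_zero {ν : ℝ} {h : ℂ → ℂ} (hh : AnalyticOnNhd ℂ h (closedBall 0 1)) :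
    discTransform ν (fun z => z * h z) 0 = ν * h 0 / 2 := by
  have hf : AnalyticOnNhd ℂ (fun z => ν * (z ^ 2 + 1) / 2 * h z) (closedBall 0 1) := by
    intro z hz
    have := hh z hz
    fun_prop
  have hcau := cauchy_circle hf (ζ := 0) (by simp)
  rw [show ν * h 0 / 2 = ν * ((0 : ℂ) ^ 2 + 1) / 2 * h 0 by ring, ← hcau, discTransform, spectralInt]
  congr 2; ext θ
  have hcos := two_cexp_mul_cos θ
  have hE0 : cexp (θ * I) ≠ 0 := Complex.exp_ne_zero _
  simp only [ofReal_zero, mul_zero, zero_mul, Complex.exp_zero, one_mul, sub_zero]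
  field_simp
  linear_combination (ν * h (cexp (θ * I))) * hcos

lemma continuous_discTransform (ν : ℝ) {H : ℂ → ℂ} (hH : AnalyticOnNhd ℂ H (closedBall 0 1)) :
    Continuous (discTransform ν H) :=
  continuous_spectralInt ν (continuous_disc_integrand ν hH)

lemma discTransform_bounded (ν : ℝ) (H : ℂ → ℂ) : ∃ C, ∀ t, ‖discTransform ν H t‖ ≤ C :=
  spectralInt_bounded ν _

lemma mul_discTransform_bounded (ν : ℝ) {H : ℂ → ℂ} (hH : AnalyticOnNhd ℂ H (closedBall 0 1)) :
    ∃ C, ∀ t : ℝ, ‖t * discTransform ν H t‖ ≤ C := by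
  simp_rw [mul_discTransform hH]
  exact spectralInt_bounded ν _

/-- Constants are invisible to the transform; this lets an initial value be subtracted from sH at no
cost. -/
lemma discTransform_const (ν : ℝ) (c : ℂ) (t : ℝ) : discTransform ν (fun _ => c) t = 0 := by
  have hH : AnalyticOnNhd ℂ (fun _ : ℂ => c) (closedBall 0 1) := fun _ _ => analyticAt_const
  by_cases ht : t = 0
  · subst ht
    simp only [discTransform, spectralInt, ofReal_zero, mul_zero, zero_mul, Complex.exp_zero,
      one_mul]
    rw [intervalIntegral.integral_mul_const, intervalIntegral.integral_const_mul,
      intervalIntegral.integral_ofReal]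
    simp
  · have := mul_discTransform (ν := ν) hH t
    simp only [deriv_const, mul_zero] at this
    have h0 : spectralInt ν (fun _ => 0) t = 0 := by simp [spectralInt]
    rw [h0] at this
    exact (mul_eq_zero.1 this).resolve_left (by exact_mod_cast ht)

lemma discTransform_add (ν : ℝ) {G H : ℂ → ℂ} (hG : AnalyticOnNhd ℂ G (closedBall 0 1))
    (hH : AnalyticOnNhd ℂ H (closedBall 0 1)) (t : ℝ) :
    discTransform ν (fun z => G z + H z) t = discTransform ν G t + discTransform ν H t := by
  have h (F : ℂ → ℂ) (hF : AnalyticOnNhd ℂ F (closedBall 0 1)) : IntervalIntegrable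
      (fun θ : ℝ => cexp (-I * ν * t * Real.sin θ) * (ν * Real.cos θ * F (cexp (θ * I))))
      volume 0 (2 * Real.pi) :=
    (Continuous.mul (by fun_prop) (continuous_disc_integrand ν hF)).intervalIntegrable _ _
  simp only [discTransform, spectralInt]
  rw [← mul_add, ← intervalIntegral.integral_add (h G hG) (h H hH)]
  congr 2; ext θ; ring

lemma discTransform_const_mul (ν : ℝ) (c : ℂ) (H : ℂ → ℂ) (t : ℝ) :
    discTransform ν (fun z => c * H z) t = c * discTransform ν H t := by
  simp only [discTransform, spectralInt]
  rw [mul_left_comm, ← intervalIntegral.integral_const_mul c]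
  congr 2; ext θ; ring

/-- Differentiating in t multiplies H by -iν sin θ, which is s = ν(1 - z²)/(2z) on the circle. The
hypothesis reads sH = G + c, the Laplace rule for a derivative with c as initial value. -/
lemma hasDerivAt_discTransform (ν : ℝ) {H G : ℂ → ℂ} (hH : AnalyticOnNhd ℂ H (closedBall 0 1))
    (hG : AnalyticOnNhd ℂ G (closedBall 0 1)) (c : ℂ)
    (hGH : ∀ z, ‖z‖ = 1 → ν * (1 - z ^ 2) * H z = 2 * z * (G z + c)) (t : ℝ) :
    HasDerivAt (discTransform ν H) (discTransform ν G t) t := by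
  have h := hasDerivAt_spectralInt ν (continuous_disc_integrand ν hH) t
  have e : discTransform ν G t = discTransform ν (fun z => G z + c) t := by
    rw [discTransform_add ν hG (fun _ _ => analyticAt_const), discTransform_const, add_zero]
  rw [e]
  convert! h using 1
  rw [discTransform]
  congr 1; ext θ
  have h1 := hGH _ (norm_cexp_mul_I θ)
  have h2 := two_cexp_mul_sin θ
  have hE0 : cexp (θ * I) ≠ 0 := Complex.exp_ne_zero _
  have : G (cexp (θ * I)) + c = ν * (-I * Real.sin θ) * H (cexp (θ * I)) := by
    apply mul_left_cancel₀ (mul_ne_zero two_ne_zero hE0)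
    linear_combination -h1 - ν * H (cexp (θ * I)) * h2
  rw [this]; ring

/-- Conjugation amounts to the substitution θ ↦ 2π - θ. -/
lemma discTransform_conj (ν : ℝ) {H : ℂ → ℂ}
    (hH : ∀ z, H (starRingEnd ℂ z) = starRingEnd ℂ (H z)) (t : ℝ) :
    (discTransform ν H t).im = 0 := by
  rw [← conj_eq_iff_im]
  simp only [discTransform, spectralInt, map_mul, map_div₀, map_one, conj_ofReal, map_ofNat]
  congr 1
  rw [← intervalIntegral.intervalIntegral_conj]
  have := intervalIntegral.integral_comp_sub_left (a := 0) (b := 2 * Real.pi) (fun θ : ℝ =>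
    cexp (-I * ν * t * Real.sin θ) * (ν * Real.cos θ * H (cexp (θ * I)))) (2 * Real.pi)
  simp only [sub_self, sub_zero] at this
  rw [← this]
  congr 1; ext θ
  simp only [map_mul, ← hH, ← Complex.exp_conj, map_neg, conj_I, conj_ofReal, Real.sin_two_pi_sub,
    Real.cos_two_pi_sub]
  have e : cexp (θ * -I) = cexp ((2 * Real.pi - θ : ℝ) * I) := by
    rw [← Complex.exp_periodic.int_mul 1]
    congr 1; push_cast; ring
  rw [e]
  congr 2
  push_cast; ring

/-- Every `s` in the right half-plane has a coordinate in the unit disc. -/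
lemma exists_disc_coordinate {ν : ℝ} (hν : 0 < ν) {s : ℂ} (hs : 0 < s.re) :
    ∃ ζ : ℂ, ‖ζ‖ < 1 ∧ 2 * s * ζ = ν * (1 - ζ ^ 2) := by
  have hνc : (ν : ℂ) ≠ 0 := by exact_mod_cast hν.ne'
  obtain ⟨r, hr⟩ := IsAlgClosed.exists_pow_nat_eq (s ^ 2 + ν ^ 2) (n := 2) (by norm_num)
  -- The two roots in ζ have product -1, so one has modulus at most 1. A root on the circle would
  -- give 2s = ν(conj ζ - ζ), which is purely imaginary.
  have key : ∀ ζ : ℂ, 2 * s * ζ = ν * (1 - ζ ^ 2) → ‖ζ‖ ≠ 1 := by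
    intro ζ h h1
    have hc : ζ * starRingEnd ℂ ζ = 1 := by
      rw [mul_conj, normSq_eq_norm_sq, h1]; simp
    have hz0 : ζ ≠ 0 := by rintro rfl; simp at h1
    have h2 : 2 * s = ν * (starRingEnd ℂ ζ - ζ) := by
      apply mul_right_cancel₀ hz0
      linear_combination h - ν * hc
    have h3 := congrArg re h2
    simp at h3
    exact hs.ne' h3
  have h1 : 2 * s * ((-s + r) / ν) = ν * (1 - ((-s + r) / ν) ^ 2) := by
    field_simp; linear_combination hr
  have h2 : 2 * s * ((-s - r) / ν) = ν * (1 - ((-s - r) / ν) ^ 2) := by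
    field_simp; linear_combination hr
  have hprod : ‖(-s + r) / ν‖ * ‖(-s - r) / ν‖ = 1 := by
    rw [← norm_mul, show (-s + r) / ν * ((-s - r) / ν) = -1 by
      field_simp; linear_combination -hr]
    simp
  rcases lt_or_ge ‖(-s + r) / ν‖ 1 with h | h
  · exact ⟨_, h, h1⟩
  · refine ⟨_, lt_of_le_of_ne ?_ (key _ h2), h2⟩
    nlinarith [norm_nonneg ((-s - r) / ν)]

/-- The convolution theorem for the disc transform. -/
lemma conv_discTransform {ν : ℝ} (hν : 0 < ν) {h : ℂ → ℂ}
    (hh : AnalyticOnNhd ℂ h (closedBall 0 1)) {t : ℝ} (ht : 0 ≤ t) :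
    ∫ u in (0 : ℝ)..t, discTransform ν (fun z => z) (t - u) * discTransform ν (fun z => z * h z) u =
      discTransform ν (fun z => z * (z * h z)) t := by
  have a1 : AnalyticOnNhd ℂ (fun z : ℂ => z) (closedBall 0 1) := fun _ _ => analyticAt_id
  have a2 : AnalyticOnNhd ℂ (fun z : ℂ => z * h z) (closedBall 0 1) := a1.mul hh
  have a3 : AnalyticOnNhd ℂ (fun z : ℂ => z * (z * h z)) (closedBall 0 1) := a1.mul a2
  have c1 := continuous_discTransform ν a1
  have c2 := continuous_discTransform ν a2
  have c3 := continuous_discTransform ν a3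
  rcases ht.eq_or_lt with rfl | ht
  · rw [discTransform_zero a2]; simp
  have cc : Continuous fun t : ℝ => ∫ u in (0 : ℝ)..t,
      discTransform ν (fun z => z) (t - u) * discTransform ν (fun z => z * h z) u := by
    refine intervalIntegral.continuous_parametric_intervalIntegral_of_continuous ?_ continuous_id
    unfold Function.uncurry; fun_prop
  have conv : ∀ s : ℂ, 0 < s.re → _ := fun s hs => laplace_conv s
    (integrableOn_cexp_mul_of_bounded hs c1 (discTransform_bounded ν _))
    (integrableOn_cexp_mul_of_bounded hs c2 (discTransform_bounded ν _))
  have i3 : ∀ s : ℂ, 0 < s.re → _ := fun s hs =>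
    integrableOn_cexp_mul_of_bounded hs c3 (discTransform_bounded ν _)
  -- Both sides have Laplace transform ζ · ζ h(ζ); injectivity concludes for t > 0.
  rw [← sub_eq_zero]
  refine eq_zero_of_laplace_eq_zero (f := fun t => (∫ u in (0 : ℝ)..t,
    discTransform ν (fun z => z) (t - u) * discTransform ν (fun z => z * h z) u) -
      discTransform ν (fun z => z * (z * h z)) t) (cc.sub c3) ?_ ?_ ht
  · simp_rw [mul_sub]
    exact (conv 1 (by simp)).1.sub (i3 1 (by simp))
  · intro s hs
    have hs' : 0 < s.re := by rw [hs]; norm_num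
    obtain ⟨ζ, hζ, hsζ⟩ := exists_disc_coordinate hν hs'
    simp_rw [mul_sub]
    rw [integral_sub (conv s hs').1 (i3 s hs'), (conv s hs').2, laplace_discTransform hν a2 hs' hζ hsζ,
      laplace_discTransform hν hh hs' hζ hsζ]
    have := laplace_discTransform hν (h := fun _ => 1) (fun _ _ => analyticAt_const) hs' hζ hsζ
    simp only [mul_one] at this
    rw [this]; ring

/-- The disc transform of the identity is the kernel `J_1(ν t)/t`. -/
lemma discTransform_id (ν t : ℝ) (ht : t ≠ 0) :
    discTransform ν (fun z => z) t = ((besselJ 1 (ν * t) / t : ℝ) : ℂ) := by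
  have hre : discTransform ν (fun z => z) t = ((discTransform ν (fun z => z) t).re : ℂ) := by
    apply Complex.ext
    · simp
    · simpa using discTransform_conj ν (H := fun z => z) (fun _ => rfl) t
  rw [hre]
  congr 1
  -- Multiplication by t replaces the amplitude ν cos θ · z by z. The real part is then the Bessel
  -- integral over [0, 2π], whose second half folds onto the first by θ ↦ 2π - θ.
  rw [eq_div_iff ht, mul_comm, ← re_ofReal_mul,
    mul_discTransform (H := fun z => z) (fun _ _ => analyticAt_id), spectralInt, besselJ]
  simp only [deriv_id'', mul_one]
  have e : ∀ θ : ℝ, cexp (-I * ν * t * Real.sin θ) * cexp (θ * I) =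
      cexp ((θ - ν * t * Real.sin θ : ℝ) * I) := by
    intro θ; rw [← Complex.exp_add]; congr 1; push_cast; ring
  simp_rw [e]
  rw [show (1 / (2 * Real.pi) : ℂ) = ((1 / (2 * Real.pi) : ℝ) : ℂ) by push_cast; rfl, re_ofReal_mul]
  have e2 : (∫ θ in (0 : ℝ)..2 * Real.pi, cexp ((θ - ν * t * Real.sin θ : ℝ) * I)).re =
      ∫ θ in (0 : ℝ)..2 * Real.pi, Real.cos (θ - ν * t * Real.sin θ) := by
    have := (intervalIntegral.intervalIntegral_re (μ := volume) (a := 0) (b := 2 * Real.pi)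
      (f := fun θ : ℝ => cexp ((θ - ν * t * Real.sin θ : ℝ) * I))
      (Continuous.intervalIntegrable (by fun_prop) _ _)).symm
    simpa only [RCLike.re_eq_complex_re, exp_ofReal_mul_I_re] using this
  rw [e2]
  have hint : ∀ a b : ℝ, IntervalIntegrable (fun θ : ℝ => Real.cos (θ - ν * t * Real.sin θ))
    volume a b := fun a b => Continuous.intervalIntegrable (by fun_prop) _ _
  rw [← intervalIntegral.integral_add_adjacent_intervals (hint 0 Real.pi) (hint Real.pi _)]
  have := intervalIntegral.integral_comp_sub_left (a := 0) (b := Real.pi)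
    (fun θ : ℝ => Real.cos (θ - ν * t * Real.sin θ)) (2 * Real.pi)
  rw [sub_zero, show 2 * Real.pi - Real.pi = Real.pi by ring] at this
  rw [← this]
  have e3 : ∀ θ : ℝ, Real.cos (2 * Real.pi - θ - ν * t * Real.sin (2 * Real.pi - θ)) =
      Real.cos (θ - ν * t * Real.sin θ) := by
    intro θ
    rw [Real.sin_two_pi_sub, ← Real.cos_neg, ← Real.cos_add_two_pi]
    congr 1; ring
  simp_rw [e3]
  simp only [Nat.cast_one, one_mul]
  ring

/-! ### The L² obstruction at the branch point. -/

/-- Cauchy–Schwarz gives a bound of order ‖f‖₂ ε^(-1/2). The part on [0, T] stays bounded, so only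
the small L² norm of the tail counts. -/
lemma sqrt_mul_laplace_tendsto_zero {f : ℝ → ℂ} (hf : Continuous f) {C : ℝ}
    (hC : ∀ t, ‖f t‖ ≤ C) (h2 : MemLp f 2 (volume.restrict (Ioi 0))) (y : ℝ) :
    Tendsto (fun ε : ℝ => √ε * ‖∫ t in Ioi (0 : ℝ), cexp (-(ε + y * I) * t) * f t‖)
      (𝓝[>] 0) (𝓝 0) := by
  have hC0 : 0 ≤ C := (norm_nonneg _).trans (hC 0)
  have hsq : IntegrableOn (fun t => ‖f t‖ ^ 2) (Ioi 0) :=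
    (memLp_two_iff_integrable_sq_norm hf.aestronglyMeasurable).1 h2
  have htail : Tendsto (fun T : ℝ => ∫ t in Ioi T, ‖f t‖ ^ 2) atTop (𝓝 0) := by
    have h1 := intervalIntegral_tendsto_integral_Ioi (0 : ℝ) hsq tendsto_id
    have h3 := h1.const_sub (∫ t in Ioi (0 : ℝ), ‖f t‖ ^ 2)
    rw [sub_self] at h3
    refine h3.congr' ?_
    filter_upwards [eventually_ge_atTop 0] with T hT
    rw [id, intervalIntegral.integral_of_le hT, sub_eq_iff_eq_add, add_comm,
      ← setIntegral_union (Ioc_disjoint_Ioi le_rfl) measurableSet_Ioi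
      (hsq.mono_set Ioc_subset_Ioi_self) (hsq.mono_set (Ioi_subset_Ioi hT)), Ioc_union_Ioi_eq_Ioi hT]
  rw [Metric.tendsto_nhds]
  intro η hη
  obtain ⟨T, hT0, hT⟩ := ((eventually_ge_atTop (0 : ℝ)).and
    (htail.eventually_lt_const (show (0 : ℝ) < (η / 2) ^ 2 by positivity))).exists
  have hsmall : Tendsto (fun ε : ℝ => √ε * (C * T)) (𝓝[>] 0) (𝓝 0) := by
    have : Tendsto (fun ε : ℝ => √ε * (C * T)) (𝓝 0) (𝓝 (√0 * (C * T))) :=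
      Continuous.tendsto (by fun_prop) 0
    rw [Real.sqrt_zero, zero_mul] at this
    exact this.mono_left nhdsWithin_le_nhds
  filter_upwards [hsmall.eventually_lt_const (show (0 : ℝ) < η / 4 by positivity),
    self_mem_nhdsWithin] with ε hε1 hε
  have hε : 0 < ε := hε
  have hsε : 0 < √ε := Real.sqrt_pos.2 hε
  have hsε2 : √ε ^ 2 = ε := Real.sq_sqrt hε.le
  rw [dist_zero_right, Real.norm_of_nonneg (by positivity)]
  have hre : 0 < ((ε : ℂ) + y * I).re := by simpa using hε
  have hint := integrableOn_cexp_mul_of_bounded hre hf ⟨C, hC⟩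
  have hexp : ∀ t : ℝ, ‖cexp (-((ε : ℂ) + y * I) * t) * f t‖ = Real.exp (-ε * t) * ‖f t‖ := by
    intro t
    rw [norm_mul, Complex.norm_exp]; simp
  rw [← Ioc_union_Ioi_eq_Ioi hT0, setIntegral_union (Ioc_disjoint_Ioi le_rfl) measurableSet_Ioi
    (hint.mono_set Ioc_subset_Ioi_self) (hint.mono_set (Ioi_subset_Ioi hT0))]
  have hhead : ‖∫ t in Ioc 0 T, cexp (-((ε : ℂ) + y * I) * t) * f t‖ ≤ C * T := by
    have := norm_setIntegral_le_of_norm_le_const (μ := volume) (s := Ioc 0 T) (C := C)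
      (f := fun t : ℝ => cexp (-((ε : ℂ) + y * I) * t) * f t) (by simp) ?_
    · simpa [hT0] using this
    · intro t ht
      rw [hexp]
      have : Real.exp (-ε * t) ≤ 1 := Real.exp_le_one_iff.2 (by nlinarith [ht.1])
      nlinarith [norm_nonneg (f t), hC t, Real.exp_pos (-ε * t)]
  -- Weight for Young's inequality on the tail: after multiplication by √ε the two terms become η/8
  -- and η/4, and the head adds less than η/4.
  set a : ℝ := η / 2 * √ε with ha
  have ha0 : 0 < a := by positivity
  have hi2 : IntegrableOn (fun t : ℝ => Real.exp (-(2 * ε) * t)) (Ioi 0) :=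
    integrableOn_exp_mul_Ioi (by linarith) 0
  have htl : ‖∫ t in Ioi T, cexp (-((ε : ℂ) + y * I) * t) * f t‖ ≤
      a / (4 * ε) + (η / 2) ^ 2 / (2 * a) := by
    calc ‖∫ t in Ioi T, cexp (-((ε : ℂ) + y * I) * t) * f t‖
        ≤ ∫ t in Ioi T, ‖cexp (-((ε : ℂ) + y * I) * t) * f t‖ := norm_integral_le_integral_norm _
      _ ≤ ∫ t in Ioi T, (a / 2 * Real.exp (-(2 * ε) * t) + 1 / (2 * a) * ‖f t‖ ^ 2) := by
          refine setIntegral_mono_on (hint.mono_set (Ioi_subset_Ioi hT0)).norm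
            (((hi2.mono_set (Ioi_subset_Ioi hT0)).const_mul _).add
              ((hsq.mono_set (Ioi_subset_Ioi hT0)).const_mul _)) measurableSet_Ioi fun t _ => ?_
          rw [hexp, show -(2 * ε) * t = -ε * t + -ε * t by ring, Real.exp_add]
          have h4 : a / 2 * (Real.exp (-ε * t) * Real.exp (-ε * t)) + 1 / (2 * a) * ‖f t‖ ^ 2 -
              Real.exp (-ε * t) * ‖f t‖ = (a * Real.exp (-ε * t) - ‖f t‖) ^ 2 / (2 * a) := by
            field_simp; ring
          have : 0 ≤ (a * Real.exp (-ε * t) - ‖f t‖) ^ 2 / (2 * a) := by positivity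
          linarith
      _ = a / 2 * (∫ t in Ioi T, Real.exp (-(2 * ε) * t)) +
            1 / (2 * a) * ∫ t in Ioi T, ‖f t‖ ^ 2 := by
          rw [integral_add ((hi2.mono_set (Ioi_subset_Ioi hT0)).const_mul _)
              ((hsq.mono_set (Ioi_subset_Ioi hT0)).const_mul _), integral_const_mul,
              integral_const_mul]
      _ ≤ a / 2 * (1 / (2 * ε)) + 1 / (2 * a) * (η / 2) ^ 2 := by
          have h5 : ∫ t in Ioi T, Real.exp (-(2 * ε) * t) ≤ 1 / (2 * ε) := by
            rw [integral_exp_mul_Ioi (by linarith), neg_div_neg_eq]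
            have : Real.exp (-(2 * ε) * T) ≤ 1 := Real.exp_le_one_iff.2 (by nlinarith)
            gcongr
          gcongr
      _ = _ := by ring
  have hfin : √ε * (a / (4 * ε) + (η / 2) ^ 2 / (2 * a)) = η / 8 + η / 4 := by
    rw [ha, show 4 * ε = 4 * √ε ^ 2 by rw [hsε2]]
    have : √ε ≠ 0 := hsε.ne'
    field_simp
    ring
  calc √ε * ‖(∫ t in Ioc 0 T, cexp (-((ε : ℂ) + y * I) * t) * f t) +
          ∫ t in Ioi T, cexp (-((ε : ℂ) + y * I) * t) * f t‖
      ≤ √ε * (C * T + (a / (4 * ε) + (η / 2) ^ 2 / (2 * a))) := by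
        gcongr
        exact (norm_add_le _ _).trans (add_le_add hhead htl)
    _ < η := by rw [mul_add, hfin]; linarith

lemma not_memLp_mul_discTransform {ν : ℝ} (hν : 0 < ν) {H : ℂ → ℂ}
    (hH : AnalyticOnNhd ℂ H (closedBall 0 1)) (hd : deriv H (-I) ≠ 0) :
    ¬ MemLp (fun t : ℝ => t * discTransform ν H t) 2 (volume.restrict (Ioi 0)) := by
  intro h2
  obtain ⟨C, hC⟩ := mul_discTransform_bounded ν hH
  have hlim := sqrt_mul_laplace_tendsto_zero
    (by have := continuous_discTransform ν hH; fun_prop) hC h2 ν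
  have hre : ∀ ε : ℝ, 0 < ε → 0 < ((ε : ℂ) + ν * I).re := fun ε hε => by simpa using hε
  have hex : ∀ ε : ℝ, ∃ ζ : ℂ, 0 < ε → ‖ζ‖ < 1 ∧ 2 * ((ε : ℂ) + ν * I) * ζ = ν * (1 - ζ ^ 2) := by
    intro ε
    by_cases hε : 0 < ε
    · obtain ⟨ζ, h⟩ := exists_disc_coordinate hν (hre ε hε)
      exact ⟨ζ, fun _ => h⟩
    · exact ⟨0, fun h => absurd h hε⟩
  choose ζ hζ using hex
  -- At s = ε + iν the coordinate equation becomes ν(ζ + i)² = -2εζ: a square-root branch point.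
  have hdist : ∀ ε : ℝ, 0 < ε → ‖ζ ε + I‖ ≤ √(2 / ν) * √ε := by
    intro ε hε
    obtain ⟨h1, h3⟩ := hζ ε hε
    rw [← Real.sqrt_mul (by positivity)]
    apply Real.le_sqrt_of_sq_le
    have h4 : ν * (ζ ε + I) ^ 2 = -2 * ε * ζ ε := by
      linear_combination (ν : ℂ) * I_sq + h3
    have h5 := congrArg norm h4
    simp only [norm_mul, norm_pow, norm_neg, norm_real, Real.norm_of_nonneg hν.le,
      Real.norm_of_nonneg hε.le, RCLike.norm_ofNat] at h5
    rw [div_mul_eq_mul_div, le_div_iff₀ hν]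
    nlinarith [norm_nonneg (ζ ε)]
  have hζlim : Tendsto ζ (𝓝[>] 0) (𝓝 (-I)) := by
    rw [tendsto_iff_norm_sub_tendsto_zero]
    have hz : Tendsto (fun ε : ℝ => √(2 / ν) * √ε) (𝓝[>] 0) (𝓝 0) := by
      have : Tendsto (fun ε : ℝ => √(2 / ν) * √ε) (𝓝 0) (𝓝 (√(2 / ν) * √0)) :=
        Continuous.tendsto (by fun_prop) 0
      rw [Real.sqrt_zero, mul_zero] at this
      exact this.mono_left nhdsWithin_le_nhds
    refine squeeze_zero' (Eventually.of_forall fun _ => norm_nonneg _) ?_ hz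
    filter_upwards [self_mem_nhdsWithin] with ε hε
    rw [sub_neg_eq_add]
    exact hdist ε hε
  have hdc : ContinuousAt (deriv H) (-I) := (hH.deriv (-I) (by simp)).continuousAt
  have hl1 : Tendsto (fun ε => ‖ζ ε‖ ^ 2 * ‖deriv H (ζ ε)‖) (𝓝[>] 0)
      (𝓝 (‖-I‖ ^ 2 * ‖deriv H (-I)‖)) :=
    (hζlim.norm.pow 2).mul (hdc.tendsto.comp hζlim).norm
  have hl2 := hlim.const_mul (ν * √(2 / ν))
  rw [mul_zero] at hl2
  -- The inequality |ζ|² |H'(ζ)| ≤ ν√(2/ν) · √ε |L|, with L the Laplace transform, passes to the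
  -- limit |H'(-i)| ≤ 0.
  have := le_of_tendsto_of_tendsto hl1 hl2 ?_
  · simp at this
    exact hd this
  · filter_upwards [self_mem_nhdsWithin] with ε hε
    have hε : 0 < ε := hε
    obtain ⟨h1, h3⟩ := hζ ε hε
    rw [laplace_mul_discTransform hν hH (hre ε hε) h1 h3]
    set L := 2 * ζ ε ^ 2 * deriv H (ζ ε) / (ν * (1 + ζ ε ^ 2)) with hL
    have hνc : (ν : ℂ) ≠ 0 := by exact_mod_cast hν.ne'
    have hne : 1 + ζ ε ^ 2 ≠ 0 := by rw [sq]; exact one_add_mul_ne_zero h1.le h1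
    have h6 : 2 * ζ ε ^ 2 * deriv H (ζ ε) = L * (ν * ((ζ ε + I) * (ζ ε - I))) := by
      rw [show (ζ ε + I) * (ζ ε - I) = 1 + ζ ε ^ 2 by linear_combination -I_sq, hL]
      field_simp
    have h7 := congrArg norm h6
    simp only [norm_mul, norm_pow, norm_real, Real.norm_of_nonneg hν.le, RCLike.norm_ofNat] at h7
    have h8 : ‖ζ ε - I‖ ≤ 2 := (norm_sub_le _ _).trans (by simp; linarith)
    have h9 : ‖L‖ * (ν * (‖ζ ε + I‖ * ‖ζ ε - I‖)) ≤ ‖L‖ * (ν * ((√(2 / ν) * √ε) * 2)) := by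
      gcongr
      exact hdist ε hε
    have h10 : ν * √(2 / ν) * (√ε * ‖L‖) * 2 = ‖L‖ * (ν * ((√(2 / ν) * √ε) * 2)) := by ring
    linarith

/-! ### From integrability to decay rates. -/

lemma memLp_two_of_decay {f : ℝ → ℝ} (hf : Continuous f) (h0 : ∃ C, ∀ t, |f t| ≤ C)
    (h1 : ∃ C, ∀ t, |t * f t| ≤ C) : MemLp f 2 volume := by
  obtain ⟨C, hC⟩ := h0
  obtain ⟨D, hD⟩ := h1
  rw [memLp_two_iff_integrable_sq hf.aestronglyMeasurable]
  refine (integrable_inv_one_add_sq.const_mul (C ^ 2 + D ^ 2)).mono'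
    (Continuous.aestronglyMeasurable (by fun_prop)) (ae_of_all _ fun t => ?_)
  rw [Real.norm_of_nonneg (by positivity), ← div_eq_mul_inv, le_div_iff₀ (by positivity)]
  have a1 := sq_le_sq.2 ((hC t).trans (le_abs_self C))
  have a2 := sq_le_sq.2 ((hD t).trans (le_abs_self D))
  linarith [mul_pow t (f t) 2, mul_comm (t ^ 2) (f t ^ 2), mul_add (f t ^ 2) 1 (t ^ 2)]

/-- Otherwise (t f)² ≤ c² t^(-1-2α) beyond T, which is integrable. -/
lemma exists_gt_of_not_memLp {f : ℝ → ℝ} (hf : Continuous f)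
    (h : ¬ MemLp (fun t => t * f t) 2 (volume.restrict (Ioi 0))) {α c T : ℝ} (hα : 0 < α)
    (hT : 0 < T) : ∃ t > T, c * t ^ (-(3 / 2 : ℝ) - α) < |f t| := by
  by_contra! hcon
  apply h
  have hcont : Continuous fun t => t * f t := by fun_prop
  rw [memLp_two_iff_integrable_sq hcont.aestronglyMeasurable, ← IntegrableOn,
    ← Ioc_union_Ioi_eq_Ioi hT.le]
  refine IntegrableOn.union ?_ ?_
  · exact (Continuous.integrableOn_Icc (by fun_prop)).mono_set Ioc_subset_Icc_self
  · refine Integrable.mono' ((integrableOn_Ioi_rpow_of_lt (show -1 - 2 * α < -1 by linarith)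
      hT).const_mul (c ^ 2)) (Continuous.aestronglyMeasurable (by fun_prop)) ?_
    refine (ae_restrict_iff' measurableSet_Ioi).2 (ae_of_all _ fun t ht => ?_)
    have ht0 : 0 < t := hT.trans ht
    rw [Real.norm_of_nonneg (by positivity), mul_pow]
    have h1 := hcon t ht
    have h2 : f t ^ 2 ≤ (c * t ^ (-(3 / 2 : ℝ) - α)) ^ 2 := by
      rw [← sq_abs]; gcongr
    calc t ^ 2 * f t ^ 2 ≤ t ^ 2 * (c * t ^ (-(3 / 2 : ℝ) - α)) ^ 2 := by gcongr
      _ = c ^ 2 * (t ^ (2 : ℝ) * (t ^ (-(3 / 2 : ℝ) - α) * t ^ (-(3 / 2 : ℝ) - α))) := by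
        rw [show t ^ (2 : ℝ) = t ^ 2 by exact_mod_cast Real.rpow_natCast t 2]; ring
      _ = c ^ 2 * t ^ (-1 - 2 * α) := by
        rw [← Real.rpow_add ht0, ← Real.rpow_add ht0]; ring_nf

lemma exists_gt_exp_of_not_memLp {f : ℝ → ℝ} (hf : Continuous f)
    (h : ¬ MemLp (fun t => t * f t) 2 (volume.restrict (Ioi 0))) {r c T : ℝ} (hr : 0 < r)
    (hT : 0 < T) : ∃ t > T, c * Real.exp (-r * t) < |f t| := by
  have h1 := (tendsto_rpow_mul_exp_neg_mul_atTop_nhds_zero (3 / 2 + 1) r hr).const_mul c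
  rw [mul_zero] at h1
  obtain ⟨S, hS⟩ := eventually_atTop.1 (h1.eventually_lt_const one_pos)
  obtain ⟨t, ht, hlt⟩ := exists_gt_of_not_memLp hf h (α := 1) (c := 1) (T := max T S) one_pos
    (hT.trans_le (le_max_left _ _))
  refine ⟨t, (le_max_left _ _).trans_lt ht, lt_of_le_of_lt ?_ hlt⟩
  have ht0 : 0 < t := hT.trans ((le_max_left _ _).trans_lt ht)
  have h2 := hS t ((le_max_right _ _).trans ht.le)
  rw [one_mul, show -(3 / 2 : ℝ) - 1 = -(3 / 2 + 1) by ring, Real.rpow_neg ht0.le,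
    ← one_div, le_div_iff₀ (by positivity)]
  linarith [mul_assoc c (Real.exp (-r * t)) (t ^ (3 / 2 + 1 : ℝ)),
    mul_comm (Real.exp (-r * t)) (t ^ (3 / 2 + 1 : ℝ)), h2]

/-! ### Weak and one-sided classical derivatives. -/

lemma isWeakDerivOn_zero {Ω : Set ℝ} {f : ℝ → ℝ} (hf : Continuous f) :
    IsWeakDerivOn 0 Ω f f :=
  ⟨hf.locallyIntegrable.locallyIntegrableOn _, hf.locallyIntegrable.locallyIntegrableOn _,
    fun φ _ _ _ => by simp⟩

lemma tsupport_iteratedDeriv_subset_tsupport (φ : ℝ → ℝ) (k : ℕ) :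
    tsupport (iteratedDeriv k φ) ⊆ tsupport φ := by
  induction k with
  | zero => simp
  | succ k ih =>
    rw [iteratedDeriv_succ]
    exact (tsupport_deriv_subset).trans ih

/-- All derivatives of φ vanish off Ω, so the integrals extend to ℝ, where integration by parts has
no boundary term. -/
lemma IsWeakDerivOn.succ {k : ℕ} {Ω : Set ℝ} {f f' g : ℝ → ℝ} (h : IsWeakDerivOn k Ω f' g)
    (hf : ∀ t, HasDerivAt f (f' t) t) (hf' : Continuous f') : IsWeakDerivOn (k + 1) Ω f g := by
  have hfc : Continuous f := continuous_iff_continuousAt.2 fun t => (hf t).continuousAt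
  refine ⟨hfc.locallyIntegrable.locallyIntegrableOn _, h.2.1, fun φ hφ hc hs => ?_⟩
  have hsm : ContDiff ℝ ∞ (iteratedDeriv k φ) := by
    rw [iteratedDeriv_eq_iterate]; exact hφ.iterate_deriv k
  have hsm' : Continuous (deriv (iteratedDeriv k φ)) := hsm.continuous_deriv (by simp)
  have hck : HasCompactSupport (iteratedDeriv k φ) :=
    hc.mono' ((subset_tsupport _).trans (tsupport_iteratedDeriv_subset_tsupport φ k))
  have hin (u : ℝ → ℝ) (j : ℕ) : ∫ x in Ω, u x * iteratedDeriv j φ x =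
      ∫ x, u x * iteratedDeriv j φ x :=
    setIntegral_eq_integral_of_forall_compl_eq_zero fun x hx => by
      rw [image_eq_zero_of_notMem_tsupport fun h' =>
        hx (hs (tsupport_iteratedDeriv_subset_tsupport φ j h')), mul_zero]
  have hparts := integral_mul_deriv_eq_deriv_mul_of_integrable (u := f) (u' := f')
    (v := iteratedDeriv k φ) (v' := deriv (iteratedDeriv k φ)) (fun x _ => hf x)
    (fun x _ => (hsm.differentiable (by simp) x).hasDerivAt)
    ((hfc.mul hsm').integrable_of_hasCompactSupport hck.deriv.mul_left)
    ((hf'.mul hsm.continuous).integrable_of_hasCompactSupport hck.mul_left)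
    ((hfc.mul hsm.continuous).integrable_of_hasCompactSupport hck.mul_left)
  have h3 := h.2.2 φ hφ hc hs
  rw [hin] at h3
  rw [hin, iteratedDeriv_succ, hparts, h3]
  ring

/-- The classical derivatives on the half-line of a globally defined `C²` function. -/
lemma timeDeriv_of_hasDerivAt {f f₁ f₂ : ℝ → ℝ} (h1 : ∀ t, HasDerivAt f (f₁ t) t)
    (h2 : ∀ t, HasDerivAt f₁ (f₂ t) t) (h3 : Continuous f₂) :
    ContDiffOn ℝ 2 f (Ici 0) ∧ (∀ t, 0 ≤ t → timeDeriv 0 f t = f t) ∧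
      (∀ t, 0 ≤ t → timeDeriv 1 f t = f₁ t) ∧ ∀ t, 0 ≤ t → timeDeriv 2 f t = f₂ t := by
  have e1 : deriv f = f₁ := funext fun t => (h1 t).deriv
  have e2 : deriv f₁ = f₂ := funext fun t => (h2 t).deriv
  have hc1 : ContDiff ℝ 1 f₁ := contDiff_one_iff_deriv.2
    ⟨fun t => (h2 t).differentiableAt, by rwa [e2]⟩
  have hc : ContDiff ℝ 2 f := by
    rw [show (2 : WithTop ℕ∞) = 1 + 1 by norm_num, contDiff_succ_iff_deriv]
    exact ⟨fun t => (h1 t).differentiableAt, by simp, by rwa [e1]⟩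
  refine ⟨hc.contDiffOn, fun t _ => by simp [timeDeriv], fun t ht => ?_, fun t ht => ?_⟩
  · rw [timeDeriv, iteratedDerivWithin_eq_iteratedDeriv (uniqueDiffOn_Ici 0)
      (hc.of_le (by norm_num)).contDiffAt ht, iteratedDeriv_one, e1]
  · rw [timeDeriv, iteratedDerivWithin_eq_iteratedDeriv (uniqueDiffOn_Ici 0)
      hc.contDiffAt ht, iteratedDeriv_succ, iteratedDeriv_one, e1, e2]

lemma hasDerivWithinAt_timeDeriv {w : ℝ → ℝ} (hw : ContDiffOn ℝ 2 w (Ici 0)) {k : ℕ}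
    (hk : k < 2) {t : ℝ} (ht : 0 ≤ t) :
    HasDerivWithinAt (timeDeriv k w) (timeDeriv (k + 1) w t) (Ici 0) t := by
  unfold timeDeriv
  rw [iteratedDerivWithin_succ]
  exact (hw.differentiableOn_iteratedDerivWithin (by exact_mod_cast hk) (uniqueDiffOn_Ici 0)
    t ht).hasDerivWithinAt

lemma continuousOn_timeDeriv {w : ℝ → ℝ} (hw : ContDiffOn ℝ 2 w (Ici 0)) {k : ℕ} (hk : k ≤ 2) :
    ContinuousOn (timeDeriv k w) (Ici 0) :=
  hw.continuousOn_iteratedDerivWithin (by exact_mod_cast hk) (uniqueDiffOn_Ici 0)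

lemma timeDeriv_zero (w : ℝ → ℝ) : timeDeriv 0 w = w := by
  ext; simp [timeDeriv]

lemma timeDeriv_sub {f g : ℝ → ℝ} (hf : ContDiffOn ℝ 2 f (Ici 0)) (hg : ContDiffOn ℝ 2 g (Ici 0))
    {k : ℕ} (hk : k ≤ 2) {t : ℝ} (ht : 0 ≤ t) :
    timeDeriv k (f - g) t = timeDeriv k f t - timeDeriv k g t :=
  iteratedDerivWithin_sub ht (uniqueDiffOn_Ici 0)
    ((hf t ht).of_le (by exact_mod_cast hk)) ((hg t ht).of_le (by exact_mod_cast hk))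

/-! ### Uniqueness by Grönwall's inequality. -/

lemma abs_le_integral_abs_timeDeriv {w : ℝ → ℝ} (hw : ContDiffOn ℝ 2 w (Ici 0)) {k : ℕ}
    (hk : k < 2) (h0 : timeDeriv k w 0 = 0) {t : ℝ} (ht : 0 ≤ t) :
    |timeDeriv k w t| ≤ ∫ u in (0 : ℝ)..t, |timeDeriv (k + 1) w u| := by
  have hc : ContinuousOn (timeDeriv (k + 1) w) (uIcc 0 t) :=
    (continuousOn_timeDeriv hw hk).mono (by rw [uIcc_of_le ht]; exact Icc_subset_Ici_self)
  have := intervalIntegral.integral_eq_sub_of_hasDeriv_right_of_le ht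
    ((continuousOn_timeDeriv hw hk.le).mono Icc_subset_Ici_self)
    (fun x hx => (hasDerivWithinAt_timeDeriv hw hk hx.1.le).mono
      (Ioi_subset_Ici hx.1.le)) hc.intervalIntegrable
  rw [h0, sub_zero] at this
  rw [← this]
  exact intervalIntegral.abs_integral_le_integral_abs ht

/-- Uniqueness for second order Volterra integro-differential equations. -/
lemma eq_zero_of_timeDeriv_two_le {w : ℝ → ℝ} (hw : ContDiffOn ℝ 2 w (Ici 0)) (h0 : w 0 = 0)
    (h1 : timeDeriv 1 w 0 = 0)
    (hb : ∀ T : ℝ, 0 ≤ T → ∃ C, 0 ≤ C ∧ ∀ t ∈ Icc 0 T, ∀ B : ℝ,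
      (∀ u ∈ Icc 0 t, |timeDeriv 1 w u| ≤ B ∧ |w u| ≤ B) → |timeDeriv 2 w t| ≤ C * B) {t : ℝ}
    (ht : 0 ≤ t) : w t = 0 := by
  obtain ⟨C, hC0, hC⟩ := hb t ht
  -- Freezing the argument at 0 for negative u makes v continuous on ℝ, so its primitive V is
  -- differentiable everywhere.
  set v : ℝ → ℝ := fun u => |timeDeriv 2 w (max 0 u)| with hv
  have hvc : Continuous v :=
    ((continuousOn_timeDeriv hw le_rfl).comp_continuous (by fun_prop)
      fun u => le_max_left 0 u).abs
  set V : ℝ → ℝ := fun t => ∫ u in (0 : ℝ)..t, v u with hV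
  have hVd : ∀ x, HasDerivAt V (v x) x := fun x =>
    (hvc.integral_hasStrictDerivAt 0 x).hasDerivAt
  have hVmono : Monotone V := monotone_of_hasDerivAt_nonneg hVd fun x => abs_nonneg _
  have hV0 : V 0 = 0 := by simp [hV]
  have hVeq : ∀ u, 0 ≤ u → V u = ∫ s in (0 : ℝ)..u, |timeDeriv 2 w s| := by
    intro u hu
    refine intervalIntegral.integral_congr fun s hs => ?_
    rw [uIcc_of_le hu] at hs
    simp only [hv, max_eq_right hs.1]
  have b1 : ∀ u, 0 ≤ u → |timeDeriv 1 w u| ≤ V u := fun u hu => by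
    rw [hVeq u hu]; exact abs_le_integral_abs_timeDeriv hw (by norm_num) h1 hu
  have b0 : ∀ u, 0 ≤ u → |w u| ≤ u * V u := by
    intro u hu
    have h := abs_le_integral_abs_timeDeriv hw (k := 0) (by norm_num)
      (by rw [timeDeriv_zero, h0]) hu
    rw [timeDeriv_zero] at h
    have hmono := intervalIntegral.integral_mono_on hu (μ := volume)
      (f := fun s => |timeDeriv 1 w s|) (g := fun _ => V u) ?_ (by simp) fun s hs =>
        (b1 s hs.1).trans (hVmono hs.2)
    · rw [intervalIntegral.integral_const, sub_zero, smul_eq_mul] at hmono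
      exact h.trans hmono
    · refine ContinuousOn.intervalIntegrable (ContinuousOn.abs ?_)
      exact (continuousOn_timeDeriv hw (by norm_num)).mono
        (by rw [uIcc_of_le hu]; exact Icc_subset_Ici_self)
  -- Both |w'| and |w| are at most B = (1 + t) V(x) on [0, x], so V' = |w''| ≤ C(1 + t) V with V(0)
  -- = 0.
  have hVzero : ∀ x ∈ Icc 0 t, V x = 0 := by
    refine eq_zero_of_abs_deriv_le_mul_abs_self_of_eq_zero_right (f' := v)
      (K := C * (1 + t)) (fun x _ => (hVd x).continuousAt.continuousWithinAt)
      (fun x _ => (hVd x).hasDerivWithinAt) hV0 fun x hx => ?_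
    have hVx : 0 ≤ V x := hV0 ▸ hVmono hx.1
    rw [Real.norm_of_nonneg hVx, hv, Real.norm_of_nonneg (abs_nonneg _), max_eq_right hx.1,
      mul_assoc]
    refine hC x ⟨hx.1, hx.2.le⟩ _ fun u hu => ⟨?_, ?_⟩
    · have := (b1 u hu.1).trans (hVmono hu.2)
      nlinarith
    · have h2 := b0 u hu.1
      have h3 := hVmono hu.2
      have h4 : u ≤ t := hu.2.trans hx.2.le
      have h5 : u * V u ≤ t * V x := mul_le_mul h4 h3 (hV0 ▸ hVmono hu.1) ht
      linarith
  have := b0 t ht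
  rw [hVzero t ⟨ht, le_rfl⟩, mul_zero] at this
  exact abs_nonpos_iff.1 this

/-! ### The damped oscillator. -/

/-- `(u + v t) exp(p t)`. -/
noncomputable def expTerm (u v p : ℂ) (t : ℝ) : ℂ := (u + v * t) * cexp (p * t)

lemma hasDerivAt_expTerm (u v p : ℂ) (t : ℝ) :
    HasDerivAt (expTerm u v p) (expTerm (v + p * u) (p * v) p t) t := by
  unfold expTerm
  have h1 : HasDerivAt (fun t : ℝ => u + v * (t : ℂ)) v t := by
    simpa using ((hasDerivAt_id t).ofReal_comp.const_mul v).const_add u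
  have h2 : HasDerivAt (fun t : ℝ => cexp (p * t)) (cexp (p * t) * p) t := by
    simpa using ((hasDerivAt_id t).ofReal_comp.const_mul p).cexp
  convert! h1.mul h2 using 1
  ring

/-- Half of the decay rate 2r is spent on the linear factor, through r t exp(-rt) ≤ 1. -/
lemma norm_expTerm_le (u v p : ℂ) {r : ℝ} (hr : 0 < r) (hp : p.re ≤ -(2 * r)) {t : ℝ}
    (ht : 0 ≤ t) : ‖expTerm u v p t‖ ≤ (‖u‖ + ‖v‖ / r) * Real.exp (-r * t) := by
  have h1 : ‖cexp (p * t)‖ ≤ Real.exp (-r * t) * Real.exp (-r * t) := by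
    rw [Complex.norm_exp, ← Real.exp_add]
    apply Real.exp_le_exp.2
    simp only [mul_re, ofReal_re, ofReal_im, mul_zero, sub_zero]
    nlinarith
  have h2 : r * t * Real.exp (-r * t) ≤ 1 := by
    have h3 : r * t ≤ Real.exp (r * t) := by linarith [Real.add_one_le_exp (r * t)]
    calc r * t * Real.exp (-r * t) ≤ Real.exp (r * t) * Real.exp (-r * t) := by gcongr
      _ = 1 := by rw [← Real.exp_add]; simp
  have h4 : Real.exp (-r * t) ≤ 1 := Real.exp_le_one_iff.2 (by nlinarith)
  have h5 : ‖u + v * t‖ ≤ ‖u‖ + ‖v‖ * t := by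
    refine (norm_add_le _ _).trans ?_
    rw [norm_mul, norm_real, Real.norm_of_nonneg ht]
  rw [expTerm, norm_mul]
  calc ‖u + v * t‖ * ‖cexp (p * t)‖
      ≤ (‖u‖ + ‖v‖ * t) * (Real.exp (-r * t) * Real.exp (-r * t)) := by gcongr
    _ = (‖u‖ * Real.exp (-r * t) + ‖v‖ / r * (r * t * Real.exp (-r * t))) * Real.exp (-r * t) := by
      field_simp
    _ ≤ (‖u‖ * 1 + ‖v‖ / r * 1) * Real.exp (-r * t) := by gcongr
    _ = _ := by ring

/-- If Re p ≥ 0, the imaginary part of the equation forces p to be real, and then every term on the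
left is nonnegative with constant term 1. -/
lemma re_neg_of_quadratic_root {a l : ℝ} (ha : 0 < a) (hl : 0 < l) {p : ℂ}
    (hp : a * p ^ 2 + l * p + 1 = 0) : p.re < 0 := by
  by_contra! h
  have h1 := congrArg re hp
  have h2 := congrArg im hp
  simp [sq] at h1 h2
  have h3 : p.im * (2 * a * p.re + l) = 0 := by linarith
  have h4 : p.im = 0 := (mul_eq_zero.1 h3).resolve_right (by positivity)
  rw [h4] at h1
  nlinarith [mul_nonneg ha.le (mul_self_nonneg p.re), mul_nonneg hl.le h]

lemma exists_damped_oscillator {a l : ℝ} (ha : 0 < a) (hl : 0 < l) (d : ℝ) :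
    ∃ y y₁ y₂ : ℝ → ℝ, (∀ t, HasDerivAt y (y₁ t) t) ∧ (∀ t, HasDerivAt y₁ (y₂ t) t) ∧
      Continuous y₂ ∧ (∀ t, a * y₂ t + l * y₁ t + y t = 0) ∧ y 0 = d ∧ y₁ 0 = 0 ∧
      ∃ r > 0, ∃ C > 0, ∀ t ≥ 0, |y t| ≤ C * Real.exp (-r * t) ∧
        |y₁ t| ≤ C * Real.exp (-r * t) ∧ |y₂ t| ≤ C * Real.exp (-r * t) := by
  have hac : (a : ℂ) ≠ 0 := by exact_mod_cast ha.ne'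
  obtain ⟨z, hz⟩ := IsAlgClosed.exists_pow_nat_eq ((l : ℂ) ^ 2 - 4 * a) (n := 2) (by norm_num)
  obtain ⟨p, hp⟩ : ∃ p : ℂ, p = (-l + z) / (2 * a) := ⟨_, rfl⟩
  obtain ⟨q, hq⟩ : ∃ q : ℂ, q = (-l - z) / (2 * a) := ⟨_, rfl⟩
  have hpe : a * p ^ 2 + l * p + 1 = 0 := by
    rw [hp]; field_simp; linear_combination hz
  have hqe : a * q ^ 2 + l * q + 1 = 0 := by
    rw [hq]; field_simp; linear_combination hz
  have hpr := re_neg_of_quadratic_root ha hl hpe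
  have hqr := re_neg_of_quadratic_root ha hl hqe
  -- The candidate is (u + vt) exp(pt) + u' exp(qt). The three equations encode y(0) = d, y'(0) = 0
  -- and the vanishing of the residue left by vt exp(pt); v is needed only for a double root, z = 0.
  obtain ⟨u, v, u', e1, e2, e3⟩ : ∃ u v u' : ℂ, u + u' = d ∧ v + p * u + q * u' = 0 ∧
      v * (2 * a * p + l) = 0 := by
    by_cases hz0 : z = 0
    · refine ⟨d, -p * d, 0, by simp, by ring, ?_⟩
      rw [hp, hz0]; field_simp; ring
    · have hpq : p - q ≠ 0 := by
        rw [hp, hq, show (-l + z) / (2 * a) - (-l - z) / (2 * a) = z / a by field_simp; ring]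
        exact div_ne_zero hz0 hac
      exact ⟨-d * q / (p - q), 0, d * p / (p - q), by field_simp; ring, by field_simp; ring,
        by simp⟩
  set r : ℝ := min (-p.re) (-q.re) / 2 with hr
  have hr0 : 0 < r := by
    have : 0 < min (-p.re) (-q.re) := lt_min (by linarith) (by linarith)
    positivity
  have hp2 : p.re ≤ -(2 * r) := by rw [hr]; linarith [min_le_left (-p.re) (-q.re)]
  have hq2 : q.re ≤ -(2 * r) := by rw [hr]; linarith [min_le_right (-p.re) (-q.re)]
  have hderiv : ∀ a₁ b₁ a₂ b₂ : ℂ, ∀ t : ℝ, HasDerivAt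
      (fun t => (expTerm a₁ b₁ p t + expTerm a₂ b₂ q t).re)
      (expTerm (b₁ + p * a₁) (p * b₁) p t + expTerm (b₂ + q * a₂) (q * b₂) q t).re t := by
    intro a₁ b₁ a₂ b₂ t
    exact reCLM.hasFDerivAt.comp_hasDerivAt t
      ((hasDerivAt_expTerm a₁ b₁ p t).add (hasDerivAt_expTerm a₂ b₂ q t))
  have hbound : ∀ a₁ b₁ a₂ b₂ : ℂ, ∃ C : ℝ, 0 ≤ C ∧ ∀ t : ℝ, 0 ≤ t →
      |(expTerm a₁ b₁ p t + expTerm a₂ b₂ q t).re| ≤ C * Real.exp (-r * t) := by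
    intro a₁ b₁ a₂ b₂
    refine ⟨(‖a₁‖ + ‖b₁‖ / r) + (‖a₂‖ + ‖b₂‖ / r), by positivity, fun t ht => ?_⟩
    rw [add_mul]
    exact (abs_re_le_norm _).trans ((norm_add_le _ _).trans
      (add_le_add (norm_expTerm_le _ _ _ hr0 hp2 ht) (norm_expTerm_le _ _ _ hr0 hq2 ht)))
  obtain ⟨C₀, hC₀, h₀⟩ := hbound u v u' 0
  obtain ⟨C₁, hC₁, h₁⟩ := hbound (v + p * u) (p * v) (0 + q * u') (q * 0)
  obtain ⟨C₂, hC₂, h₂⟩ := hbound (p * v + p * (v + p * u)) (p * (p * v))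
    (q * 0 + q * (0 + q * u')) (q * (q * 0))
  refine ⟨_, _, _, hderiv u v u' 0, hderiv _ _ _ _, ?_, fun t => ?_, ?_, ?_, r, hr0,
    C₀ + C₁ + C₂ + 1, by positivity, fun t ht => ⟨(h₀ t ht).trans ?_, (h₁ t ht).trans ?_,
      (h₂ t ht).trans ?_⟩⟩
  · exact continuous_iff_continuousAt.2 fun t => (hderiv _ _ _ _ t).continuousAt
  · rw [← re_ofReal_mul, ← re_ofReal_mul, ← add_re, ← add_re]
    have : a * (expTerm (p * v + p * (v + p * u)) (p * (p * v)) p t +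
        expTerm (q * 0 + q * (0 + q * u')) (q * (q * 0)) q t) +
        l * (expTerm (v + p * u) (p * v) p t + expTerm (0 + q * u') (q * 0) q t) +
        (expTerm u v p t + expTerm u' 0 q t) = 0 := by
      simp only [expTerm]
      linear_combination ((u + v * t) * cexp (p * t)) * hpe + (cexp (p * t)) * e3 +
        (u' * cexp (q * t)) * hqe
    rw [this, zero_re]
  · simp only [expTerm, ofReal_zero, mul_zero, add_zero, Complex.exp_zero, mul_one, e1, ofReal_re]
  · simp only [expTerm, ofReal_zero, mul_zero, add_zero, Complex.exp_zero, mul_one, zero_add, e2,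
      zero_re]
  all_goals gcongr; linarith

lemma nonDispersive_unique {τbuoy ℓ δ₀ : ℝ} {heq : ℝ → ℝ} (hτ : 0 < tauSq τbuoy ℓ heq 0)
    (hℓ : 0 < ℓ) {η η' : ℝ → ℝ} (h : IsNonDispersiveSolution τbuoy ℓ heq δ₀ η)
    (h' : IsNonDispersiveSolution τbuoy ℓ heq δ₀ η') : EqOn η' η (Ici 0) := by
  intro t ht
  obtain ⟨c, e, i0, i1⟩ := h
  obtain ⟨c', e', i0', i1'⟩ := h'
  rw [← sub_eq_zero]
  refine eq_zero_of_timeDeriv_two_le (w := η' - η) (c'.sub c) (by simp [i0, i0'])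
    (by rw [timeDeriv_sub c' c (by norm_num) le_rfl, i1, i1', sub_zero]) (fun T hT => ?_) ht
  refine ⟨(ℓ + 1) / tauSq τbuoy ℓ heq 0, by positivity, fun t ht B hB => ?_⟩
  obtain ⟨b1, b0⟩ := hB t ⟨ht.1, le_rfl⟩
  have h1 := timeDeriv_sub c' c (k := 1) (by norm_num) ht.1
  have h2 := timeDeriv_sub c' c (k := 2) (by norm_num) ht.1
  have hE : tauSq τbuoy ℓ heq 0 * timeDeriv 2 (η' - η) t =
      -(ℓ * timeDeriv 1 (η' - η) t + (η' - η) t) := by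
    rw [h1, h2, Pi.sub_apply]
    linear_combination e' t ht.1 - e t ht.1
  have h3 : tauSq τbuoy ℓ heq 0 * |timeDeriv 2 (η' - η) t| ≤ (ℓ + 1) * B := by
    rw [show tauSq τbuoy ℓ heq 0 * |timeDeriv 2 (η' - η) t| =
      |tauSq τbuoy ℓ heq 0 * timeDeriv 2 (η' - η) t| by rw [abs_mul, abs_of_pos hτ], hE, abs_neg]
    refine (abs_add_le _ _).trans ?_
    rw [abs_mul, abs_of_pos hℓ]
    nlinarith
  rw [div_mul_eq_mul_div, le_div_iff₀ hτ]
  linarith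

/-! ### The denominator of the transformed equation. -/

/-- The polynomial `4 z² (A s² + ℓ s z + 1)` with `s = ν (1/z - z)/2`, `a = A ν²`, `b = ℓ ν`. -/
def symbolPoly (a b : ℝ) (z : ℂ) : ℂ :=
  a * (1 - z ^ 2) ^ 2 + 2 * b * z ^ 2 * (1 - z ^ 2) + 4 * z ^ 2

/-- In w = z² this is the real quadratic p w² + q w + a with |p| < a. A nonreal root would satisfy a
= p|w|², impossible for |w| ≤ 1. For real w it equals (1 - w)(a - pw) + 4w, and also (1 + w)(a + pw)
- 4(a - b - 1)w; these are positive for 0 < w ≤ 1 and -1 ≤ w < 0 respectively, the latter thanks to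
a - b > 1. -/
lemma symbolPoly_ne_zero {a b : ℝ} (hb : 0 < b) (hab : 1 < a - b) {z : ℂ} (hz : ‖z‖ ≤ 1) :
    symbolPoly a b z ≠ 0 := by
  intro h
  obtain ⟨w, hw⟩ : ∃ w, w = z ^ 2 := ⟨_, rfl⟩
  have hw1 : w.re ^ 2 + w.im ^ 2 ≤ 1 := by
    have h1 : ‖w‖ ≤ 1 := by rw [hw, norm_pow]; exact pow_le_one₀ (norm_nonneg _) hz
    have h2 := normSq_eq_norm_sq w
    rw [normSq_apply] at h2
    nlinarith [norm_nonneg w]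
  obtain ⟨p, hp⟩ : ∃ p : ℝ, p = a - 2 * b := ⟨_, rfl⟩
  obtain ⟨q, hq⟩ : ∃ q : ℝ, q = 4 + 2 * b - 2 * a := ⟨_, rfl⟩
  have hP : (p : ℂ) * w ^ 2 + q * w + a = 0 := by
    rw [← h, symbolPoly, hp, hq, hw]; push_cast; ring
  have hre := congrArg re hP
  have him := congrArg im hP
  simp [sq] at hre him
  have hpa : p < a := by linarith
  have hpa' : -a < p := by linarith
  have him' : w.im * (2 * p * w.re + q) = 0 := by linarith
  rcases mul_eq_zero.1 him' with h0 | h0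
  · rw [h0] at hre hw1
    have hx : |w.re| ≤ 1 := by
      rw [← sq_le_one_iff_abs_le_one]; linarith
    obtain ⟨hx1, hx2⟩ := abs_le.1 hx
    rcases le_total 0 w.re with hx0 | hx0
    · rcases hx0.eq_or_lt with hx0 | hx0
      · rw [← hx0] at hre; linarith
      · have e1 : 0 ≤ (1 - w.re) * (a - p * w.re) :=
          mul_nonneg (by linarith) (by nlinarith)
        nlinarith
    · rcases hx0.eq_or_lt with hx0 | hx0
      · rw [hx0] at hre; linarith
      · have e1 : 0 ≤ (1 + w.re) * (a + p * w.re) :=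
          mul_nonneg (by linarith) (by nlinarith)
        nlinarith
  · have e2 : a = p * (w.re ^ 2 + w.im ^ 2) := by
      have : q = -(2 * p * w.re) := by linarith
      rw [this] at hre; linarith
    rcases le_total 0 p with hp0 | hp0
    · nlinarith
    · nlinarith [sq_nonneg w.re, sq_nonneg w.im]

lemma analyticOnNhd_div_symbolPoly {a b : ℝ} (hb : 0 < b) (hab : 1 < a - b) {n : ℂ → ℂ}
    (hn : AnalyticOnNhd ℂ n (closedBall 0 1)) :
    AnalyticOnNhd ℂ (fun z => n z / symbolPoly a b z) (closedBall 0 1) := by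
  intro z hz
  refine (hn z hz).div ?_ (symbolPoly_ne_zero hb hab (by simpa using hz))
  unfold symbolPoly
  fun_prop

/-- The expression in `h` is the quotient-rule numerator n'P - nP' at -i, where P = 4(a - b - 1) and
P' = -2i(-4a + 6b + 4). -/
lemma deriv_div_symbolPoly_ne_zero {a b : ℝ} (hb : 0 < b) (hab : 1 < a - b) {n : ℂ → ℂ} {n' : ℂ}
    (hn : HasDerivAt n n' (-I))
    (h : n' * (4 * (a - b - 1)) + 2 * I * (-4 * a + 6 * b + 4) * n (-I) ≠ 0) :
    deriv (fun z => n z / symbolPoly a b z) (-I) ≠ 0 := by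
  have hP0 : symbolPoly a b (-I) ≠ 0 := symbolPoly_ne_zero hb hab (by simp)
  have hPv : symbolPoly a b (-I) = 4 * (a - b - 1) := by
    rw [symbolPoly, neg_sq, I_sq]; ring
  have hPd : HasDerivAt (symbolPoly a b) (-2 * I * (-4 * a + 6 * b + 4)) (-I) := by
    have h2 : HasDerivAt (fun z : ℂ => z ^ 2) (2 * -I) (-I) := by
      simpa using hasDerivAt_pow 2 (-I)
    have h1 : HasDerivAt (fun z : ℂ => 1 - z ^ 2) (-(2 * -I)) (-I) := h2.const_sub 1
    have := (((h1.pow 2).const_mul (a : ℂ)).add ((h2.const_mul (2 * b : ℂ)).mul h1)).add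
      (h2.const_mul 4)
    unfold symbolPoly
    convert! this using 1
    simp only [neg_sq, I_sq]; push_cast; ring
  rw [(hn.fun_div hPd hP0).deriv]
  refine div_ne_zero ?_ (pow_ne_zero _ hP0)
  rw [hPv]
  convert h using 1
  ring

/-! ### Construction and uniqueness of the dispersive solution. -/

/-- The continuous version of the kernel `J_1(ν t)/t`. -/
noncomputable def smoothKernel (ν t : ℝ) : ℝ := (discTransform ν (fun z => z) t).re

lemma continuous_smoothKernel (ν : ℝ) : Continuous (smoothKernel ν) :=
  continuous_re.comp (continuous_discTransform ν analyticOnNhd_id)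

/-- The two kernels can differ only at u = t, where division by zero gives `kernelK1` the value 0.
-/
lemma causalConv_kernelK1 (μ : ℝ) (g : ℝ → ℝ) (t : ℝ) :
    causalConv (kernelK1 μ) g t =
      ∫ u in (0 : ℝ)..t, smoothKernel (1 / kappa μ) (t - u) * g u := by
  refine intervalIntegral.integral_congr_ae ?_
  filter_upwards [(countable_singleton t).ae_notMem volume] with u hu _
  have hu' : t - u ≠ 0 := fun h => hu (by rw [mem_singleton_iff]; linarith)
  rw [smoothKernel, discTransform_id _ _ hu', ofReal_re, kernelK1, one_div, inv_mul_eq_div]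

lemma exists_dispersive {A ℓ ν : ℝ} (hν : 0 < ν) (hℓ : 0 < ℓ)
    (hA : 1 < A * ν ^ 2 - ℓ * ν) (d : ℝ) :
    ∃ y : Fin 3 → ℝ → ℝ, (∀ t, HasDerivAt (y 0) (y 1 t) t) ∧ (∀ t, HasDerivAt (y 1) (y 2 t) t) ∧
      (∀ i, Continuous (y i)) ∧
      (∀ t, 0 ≤ t → A * y 2 t + ℓ * (∫ u in (0 : ℝ)..t, smoothKernel ν (t - u) * y 1 u) +
        y 0 t = 0) ∧ y 0 0 = d ∧ y 1 0 = 0 ∧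
      (∀ i, ∃ C, ∀ t, |y i t| ≤ C) ∧ (∀ i, ∃ C, ∀ t, |t * y i t| ≤ C) ∧
      (d ≠ 0 → ∀ i, ¬ MemLp (fun t => t * y i t) 2 (volume.restrict (Ioi 0))) := by
  obtain ⟨a, ha⟩ : ∃ a, a = A * ν ^ 2 := ⟨_, rfl⟩
  obtain ⟨b, hb⟩ : ∃ b, b = ℓ * ν := ⟨_, rfl⟩
  have hb0 : 0 < b := by rw [hb]; positivity
  have hab : 1 < a - b := by rw [ha, hb]; exact hA
  have hνc : (ν : ℂ) ≠ 0 := by exact_mod_cast hν.ne'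
  have hbc : (b : ℂ) ≠ 0 := by exact_mod_cast hb0.ne'
  -- With D = As² + ℓsζ + 1, the transformed equation gives d(As + ℓζ)/D for y, -d/D for y' and
  -- -ds/D for y''. Multiplying top and bottom by 4ζ² yields these numerators over `symbolPoly`; `m`
  -- is `n` with one factor z removed.
  set n : Fin 3 → ℂ → ℂ := ![
    fun z => 2 * d / ν * z * (a * (1 - z ^ 2) + 2 * b * z ^ 2),
    fun z => -4 * d * z ^ 2,
    fun z => -2 * ν * d * z * (1 - z ^ 2)] with hn
  set m : Fin 3 → ℂ → ℂ := ![
    fun z => 2 * d / ν * (a * (1 - z ^ 2) + 2 * b * z ^ 2),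
    fun z => -4 * d * z,
    fun z => -2 * ν * d * (1 - z ^ 2)] with hm
  set H : Fin 3 → ℂ → ℂ := fun i z => n i z / symbolPoly a b z with hH
  have hHm : ∀ i, H i = fun z => z * (m i z / symbolPoly a b z) := by
    intro i; ext z
    simp only [hH]
    fin_cases i <;> simp [hn, hm] <;> ring
  have hma : ∀ i, AnalyticOnNhd ℂ (fun z => m i z / symbolPoly a b z) (closedBall 0 1) := by
    intro i
    apply analyticOnNhd_div_symbolPoly hb0 hab
    fin_cases i <;> simp only [hm] <;> intro z _ <;> simp <;> fun_prop
  have hHa : ∀ i, AnalyticOnNhd ℂ (H i) (closedBall 0 1) := by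
    intro i; rw [hHm]; exact analyticOnNhd_id.mul (hma i)
  have hconj : ∀ i z, H i (starRingEnd ℂ z) = starRingEnd ℂ (H i z) := by
    intro i z
    fin_cases i <;> simp [hH, hn, symbolPoly, map_ofNat]
  have hreal : ∀ i t, (((discTransform ν (H i) t).re : ℝ) : ℂ) = discTransform ν (H i) t := by
    intro i t
    apply Complex.ext
    · simp
    · simpa using (discTransform_conj ν (hconj i) t).symm
  have hkreal : ∀ t, ((smoothKernel ν t : ℝ) : ℂ) = discTransform ν (fun z => z) t := by
    intro t
    apply Complex.ext
    · simp [smoothKernel]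
    · simpa using (discTransform_conj ν (H := fun z => z) (fun _ => rfl) t).symm
  have hcd : ∀ i, Continuous (discTransform ν (H i)) := fun i => continuous_discTransform ν (hHa i)
  refine ⟨fun i t => (discTransform ν (H i) t).re, fun t => ?_, fun t => ?_,
    fun i => continuous_re.comp (hcd i), fun t ht => ?_, ?_, ?_, fun i => ?_, fun i => ?_,
    fun hd i h2 => ?_⟩
  · refine reCLM.hasFDerivAt.comp_hasDerivAt t
      (hasDerivAt_discTransform ν (hHa 0) (hHa 1) d (fun z hz => ?_) t)
    have hP := symbolPoly_ne_zero hb0 hab hz.le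
    simp only [hH, hn, Matrix.cons_val_zero, Matrix.cons_val_one]
    field_simp
    rw [symbolPoly]; ring
  · refine reCLM.hasFDerivAt.comp_hasDerivAt t
      (hasDerivAt_discTransform ν (hHa 1) (hHa 2) 0 (fun z hz => ?_) t)
    have hP := symbolPoly_ne_zero hb0 hab hz.le
    simp [hH, hn]
    field_simp
    ring
  · have hc := conv_discTransform hν (hma 1) ht
    rw [← hHm] at hc
    -- The transformed equation. The numerators cancel identically, so this holds even where
    -- `symbolPoly` vanishes.
    have hsum : ∀ z, A * H 2 z + (ℓ * (z * H 1 z) + H 0 z) = 0 := by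
      intro z
      simp [hH, hn]
      rw [ha, hb, div_eq_mul_inv, div_eq_mul_inv, div_eq_mul_inv]
      field_simp
      push_cast
      ring
    have hzH : AnalyticOnNhd ℂ (fun z => z * H 1 z) (closedBall 0 1) := analyticOnNhd_id.mul (hHa 1)
    have h0 := discTransform_const ν 0 t
    rw [show (fun _ : ℂ => (0 : ℂ)) = fun z => A * H 2 z + (ℓ * (z * H 1 z) + H 0 z) from
      funext fun z => (hsum z).symm,
      discTransform_add ν (G := fun z => A * H 2 z) (H := fun z => ℓ * (z * H 1 z) + H 0 z)
        (analyticOnNhd_const.mul (hHa 2)) ((analyticOnNhd_const.mul hzH).add (hHa 0)),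
      discTransform_add ν (G := fun z => ℓ * (z * H 1 z)) (analyticOnNhd_const.mul hzH) (hHa 0),
      discTransform_const_mul, discTransform_const_mul] at h0
    have hmz : (fun z => z * (z * (m 1 z / symbolPoly a b z))) = fun z => z * H 1 z := by
      rw [hHm]
    rw [← hmz, ← hc] at h0
    have : ((A * (discTransform ν (H 2) t).re +
        ℓ * (∫ u in (0 : ℝ)..t, smoothKernel ν (t - u) * (discTransform ν (H 1) u).re) +
        (discTransform ν (H 0) t).re : ℝ) : ℂ) = 0 := by
      push_cast
      rw [← intervalIntegral.integral_ofReal]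
      push_cast
      simp_rw [hreal, hkreal]
      linear_combination h0
    exact_mod_cast this
  · show (discTransform ν (H 0) 0).re = d
    rw [hHm, discTransform_zero (hma 0)]
    have ha0 : (a : ℂ) ≠ 0 := by
      have : 0 < a := by linarith
      exact_mod_cast this.ne'
    have : (ν : ℂ) * (m 0 0 / symbolPoly a b 0) / 2 = d := by
      simp [hm, symbolPoly]
      field_simp
    rw [this, ofReal_re]
  · show (discTransform ν (H 1) 0).re = 0
    rw [hHm, discTransform_zero (hma 1)]
    simp [hm]
  · obtain ⟨C, hC⟩ := discTransform_bounded ν (H i)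
    exact ⟨C, fun t => (abs_re_le_norm _).trans (hC t)⟩
  · obtain ⟨C, hC⟩ := mul_discTransform_bounded ν (hHa i)
    refine ⟨C, fun t => ?_⟩
    rw [← re_ofReal_mul]
    exact (abs_re_le_norm _).trans (hC t)
  · have hdc : (d : ℂ) ≠ 0 := by exact_mod_cast hd
    refine not_memLp_mul_discTransform hν (hHa i) ?_ ?_
    · have hsq : HasDerivAt (fun z : ℂ => z ^ 2) (2 * -I) (-I) := by
        simpa using hasDerivAt_pow 2 (-I)
      have hid := hasDerivAt_id (-I)
      -- In each case the quotient-rule numerator at -i collapses to a nonzero multiple of b d.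
      fin_cases i
      · refine deriv_div_symbolPoly_ne_zero hb0 hab (n := n 0) (n' := 2 * d / ν * (4 * a - 6 * b))
          ?_ ?_
        · have := (hid.const_mul (2 * d / ν : ℂ)).mul
            (((hsq.const_sub 1).const_mul (a : ℂ)).add (hsq.const_mul (2 * b : ℂ)))
          convert! this using 1
          simp [I_sq]
          linear_combination (2 * d / ν * (2 * a - 4 * b)) * I_sq
        · have : 2 * (d : ℂ) / ν * (4 * a - 6 * b) * (4 * (a - b - 1)) +
              2 * I * (-4 * a + 6 * b + 4) * n 0 (-I) = 2 * d / ν * (8 * b) := by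
            simp [hn, I_sq]
            linear_combination (-(2 * d / ν) *
              (2 * (-4 * a + 6 * b + 4) * (2 * a - 2 * b))) * I_sq
          rw [this]
          simp [hdc, hνc, hbc]
      · refine deriv_div_symbolPoly_ne_zero hb0 hab (n := n 1) (n' := -4 * d * (2 * -I)) ?_ ?_
        · exact hsq.const_mul _
        · have : -4 * (d : ℂ) * (2 * -I) * (4 * (a - b - 1)) +
              2 * I * (-4 * a + 6 * b + 4) * n 1 (-I) = 16 * b * d * I := by
            simp [hn, I_sq]
            ring
          rw [this]
          simp [hdc, hbc]
      · refine deriv_div_symbolPoly_ne_zero hb0 hab (n := n 2) (n' := -8 * ν * d) ?_ ?_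
        · have := (hid.const_mul (-2 * ν * d : ℂ)).mul (hsq.const_sub 1)
          convert! this using 1
          simp [I_sq]
          linear_combination (-4 * ν * d) * I_sq
        · have : -8 * (ν : ℂ) * d * (4 * (a - b - 1)) +
              2 * I * (-4 * a + 6 * b + 4) * n 2 (-I) = -16 * ν * d * b := by
            simp [hn, I_sq]
            linear_combination (8 * ν * d * (-4 * a + 6 * b + 4)) * I_sq
          rw [this]
          simp [hdc, hbc, hνc]
    · have := h2.ofReal (K := ℂ)
      refine this.congr_norm ?_ ?_
      · have := hcd i
        exact Continuous.aestronglyMeasurable (by fun_prop)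
      · refine ae_of_all _ fun t => ?_
        rw [← hreal i t]
        simp

lemma dispersive_unique {τbuoy ℓ μ δ₀ : ℝ} {heq : ℝ → ℝ}
    (hA : 0 < tauSq τbuoy ℓ heq μ + ℓ * kappa μ) (hℓ : 0 < ℓ) {δ δ' : ℝ → ℝ}
    (h : IsDispersiveSolution τbuoy ℓ heq μ δ₀ δ)
    (h' : IsDispersiveSolution τbuoy ℓ heq μ δ₀ δ') : EqOn δ' δ (Ici 0) := by
  intro t ht
  obtain ⟨c, e, i0, i1⟩ := h
  obtain ⟨c', e', i0', i1'⟩ := h'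
  obtain ⟨M, hM⟩ : ∃ M, ∀ t, |smoothKernel (1 / kappa μ) t| ≤ M := by
    obtain ⟨C, hC⟩ := discTransform_bounded (1 / kappa μ) (fun z => z)
    exact ⟨C, fun t => (abs_re_le_norm _).trans (hC t)⟩
  have hM0 : 0 ≤ M := (abs_nonneg _).trans (hM 0)
  rw [← sub_eq_zero]
  refine eq_zero_of_timeDeriv_two_le (w := δ' - δ) (c'.sub c) (by simp [i0, i0'])
    (by rw [timeDeriv_sub c' c (by norm_num) le_rfl, i1, i1', sub_zero]) (fun T hT => ?_) ht
  set A := tauSq τbuoy ℓ heq μ + ℓ * kappa μ with hAdef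
  -- The convolution contributes at most MTB, M bounding the kernel, and the zeroth-order term at
  -- most B.
  refine ⟨(ℓ * (M * T) + 1) / A, by positivity, fun t ht B hB => ?_⟩
  have hB0 : 0 ≤ B := (abs_nonneg _).trans (hB t ⟨ht.1, le_rfl⟩).2
  have hi : ∀ f : ℝ → ℝ, ContDiffOn ℝ 2 f (Ici 0) → IntervalIntegrable
      (fun u => smoothKernel (1 / kappa μ) (t - u) * timeDeriv 1 f u) volume 0 t := by
    intro f hf
    refine ContinuousOn.intervalIntegrable (ContinuousOn.mul ?_ ?_)
    · have := continuous_smoothKernel (1 / kappa μ)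
      exact Continuous.continuousOn (by fun_prop)
    · exact (continuousOn_timeDeriv hf (by norm_num)).mono
        (by rw [uIcc_of_le ht.1]; exact Icc_subset_Ici_self)
  have hconv : causalConv (kernelK1 μ) (timeDeriv 1 δ') t - causalConv (kernelK1 μ) (timeDeriv 1 δ) t
      = ∫ u in (0 : ℝ)..t, smoothKernel (1 / kappa μ) (t - u) * timeDeriv 1 (δ' - δ) u := by
    rw [causalConv_kernelK1, causalConv_kernelK1, ← intervalIntegral.integral_sub (hi _ c') (hi _ c)]
    refine intervalIntegral.integral_congr fun u hu => ?_
    rw [uIcc_of_le ht.1] at hu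
    simp only [timeDeriv_sub c' c (k := 1) (by norm_num) hu.1, mul_sub]
  have hconvB : |∫ u in (0 : ℝ)..t, smoothKernel (1 / kappa μ) (t - u) * timeDeriv 1 (δ' - δ) u| ≤
      M * B * T := by
    have := intervalIntegral.norm_integral_le_of_norm_le_const (a := 0) (b := t) (C := M * B)
      (f := fun u => smoothKernel (1 / kappa μ) (t - u) * timeDeriv 1 (δ' - δ) u) ?_
    · rw [sub_zero, abs_of_nonneg ht.1, Real.norm_eq_abs] at this
      exact this.trans (mul_le_mul_of_nonneg_left ht.2 (by positivity))
    · intro u hu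
      rw [uIoc_of_le ht.1] at hu
      rw [Real.norm_eq_abs, abs_mul]
      exact mul_le_mul (hM _) (hB u ⟨hu.1.le, hu.2⟩).1 (abs_nonneg _) hM0
  have h2 := timeDeriv_sub c' c (k := 2) (by norm_num) ht.1
  have hE : A * timeDeriv 2 (δ' - δ) t = -(ℓ * (∫ u in (0 : ℝ)..t,
      smoothKernel (1 / kappa μ) (t - u) * timeDeriv 1 (δ' - δ) u) + (δ' - δ) t) := by
    rw [h2, ← hconv, Pi.sub_apply]
    linear_combination e' t ht.1 - e t ht.1
  have h3 : A * |timeDeriv 2 (δ' - δ) t| ≤ (ℓ * (M * T) + 1) * B := by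
    rw [show A * |timeDeriv 2 (δ' - δ) t| = |A * timeDeriv 2 (δ' - δ) t| by
      rw [abs_mul, abs_of_pos hA], hE, abs_neg]
    refine (abs_add_le _ _).trans ?_
    rw [abs_mul, abs_of_pos hℓ]
    have := mul_le_mul_of_nonneg_left hconvB hℓ.le
    linarith [(hB t ⟨ht.1, le_rfl⟩).2]
  rw [div_mul_eq_mul_div, le_div_iff₀ hA]
  linarith

/-! ### Positivity of the coefficients and conclusion. -/

lemma integral_sq_div_pos {ℓ : ℝ} {heq : ℝ → ℝ} (hℓ : 0 < ℓ)
    (h_heq : ∀ x ∈ Icc 0 ℓ, 0 < heq x ∧ heq x ≤ 1)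
    (h_int : IntervalIntegrable (fun x => x ^ 2 / heq x) volume 0 ℓ) :
    0 < ∫ x in (0 : ℝ)..ℓ, x ^ 2 / heq x := by
  have h1 : ∫ x in (0 : ℝ)..ℓ, x ^ 2 ≤ ∫ x in (0 : ℝ)..ℓ, x ^ 2 / heq x := by
    refine intervalIntegral.integral_mono_on hℓ.le
      (Continuous.intervalIntegrable (by fun_prop) _ _) h_int fun x hx => ?_
    rw [le_div_iff₀ (h_heq x hx).1]
    exact mul_le_of_le_one_right (sq_nonneg x) (h_heq x hx).2
  rw [integral_pow] at h1
  refine lt_of_lt_of_le ?_ h1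
  norm_num
  positivity

lemma memSobolev_of_hasDerivAt {p : ℝ≥0∞} {Ω : Set ℝ} {y : Fin 3 → ℝ → ℝ}
    (h1 : ∀ t, HasDerivAt (y 0) (y 1 t) t) (h2 : ∀ t, HasDerivAt (y 1) (y 2 t) t)
    (hc : ∀ i, Continuous (y i)) (hp : ∀ i, MemLp (y i) p (volume.restrict Ω)) :
    MemSobolev 2 p Ω (y 0) := by
  intro k hk
  interval_cases k
  · exact ⟨y 0, isWeakDerivOn_zero (hc 0), hp 0⟩
  · exact ⟨y 1, (isWeakDerivOn_zero (hc 1)).succ h1 (hc 1), hp 1⟩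
  · exact ⟨y 2, ((isWeakDerivOn_zero (hc 2)).succ h2 (hc 2)).succ h1 (hc 1), hp 2⟩

end Cummins

end

theorem mainTheorem9
    (τbuoy ℓ μ δ₀ : ℝ) (heq : ℝ → ℝ)
    (hτ : 0 ≤ τbuoy) (hℓ : 0 < ℓ) (hμ : 0 < μ)
    (h_heq : ∀ x ∈ Icc 0 ℓ, 0 < heq x ∧ heq x ≤ 1)
    (h_int : IntervalIntegrable (fun x => x ^ 2 / heq x) volume 0 ℓ) :
    (∃ δ : ℝ → ℝ,
      -- existence and uniqueness in C² ∩ W^{1,∞}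
      (Cummins.IsDispersiveSolution τbuoy ℓ heq μ δ₀ δ ∧ Cummins.MemSobolev 1 ∞ (Ioi 0) δ) ∧
      (∀ δ' : ℝ → ℝ,
        Cummins.IsDispersiveSolution τbuoy ℓ heq μ δ₀ δ' → Cummins.MemSobolev 1 ∞ (Ioi 0) δ' →
          EqOn δ' δ (Ici 0)) ∧
      -- δ ∈ H²
      Cummins.MemSobolev 2 2 (Ioi 0) δ ∧
      -- t δ^{(k)} ∉ L², lower bound on the decay, and no exponential decay
      (δ₀ ≠ 0 → ∀ k ≤ 2,
        (¬ MemLp (fun t => t * Cummins.timeDeriv k δ t) 2 (volume.restrict (Ioi 0))) ∧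
        (∀ α > 0, ∀ c > 0, ∀ T₀ > 0, ∃ t > T₀,
          c * t ^ (-(3 / 2 : ℝ) - α) < |Cummins.timeDeriv k δ t|) ∧
        (∀ r > 0, ∀ c > 0, ∀ T₀ > 0, ∃ t > T₀,
          c * Real.exp (-r * t) < |Cummins.timeDeriv k δ t|))) ∧
    -- the non dispersive return to equilibrium is exponential
    (∃ η : ℝ → ℝ, Cummins.IsNonDispersiveSolution τbuoy ℓ heq δ₀ η ∧
      (∀ η' : ℝ → ℝ, Cummins.IsNonDispersiveSolution τbuoy ℓ heq δ₀ η' → EqOn η' η (Ici 0)) ∧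
      ∃ r > 0, ∃ C > 0, ∀ k ≤ 2, ∀ t ≥ 0,
        |Cummins.timeDeriv k η t| ≤ C * Real.exp (-r * t)) := by
  have hI := Cummins.integral_sq_div_pos hℓ h_heq h_int
  have hκ : 0 < Cummins.kappa μ := Real.sqrt_pos.2 (by positivity)
  have hτ₀ : 0 < Cummins.tauSq τbuoy ℓ heq 0 := by
    have : 0 < (1 / ℓ) * ∫ x in (0 : ℝ)..ℓ, x ^ 2 / heq x := by positivity
    have h0 : (0 : ℝ) ^ 2 / heq ℓ = 0 := by simp
    simp only [Cummins.tauSq, Cummins.kappa, zero_div, Real.sqrt_zero, h0]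
    nlinarith [sq_nonneg τbuoy]
  -- From h_eq(ℓ) ≤ 1 one gets κ²/h_eq(ℓ) ≥ κ²; the positive integral makes the inequality strict.
  have hτμ : Cummins.kappa μ ^ 2 < Cummins.tauSq τbuoy ℓ heq μ := by
    have h1 : 0 < (1 / ℓ) * ∫ x in (0 : ℝ)..ℓ, x ^ 2 / heq x := by positivity
    obtain ⟨h2, h3⟩ := h_heq ℓ ⟨hℓ.le, le_rfl⟩
    have h4 : Cummins.kappa μ ^ 2 ≤ Cummins.kappa μ ^ 2 / heq ℓ := by
      rw [le_div_iff₀ h2]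
      exact mul_le_of_le_one_right (sq_nonneg _) h3
    rw [Cummins.tauSq]
    nlinarith [sq_nonneg τbuoy]
  have hA0 : 0 < Cummins.tauSq τbuoy ℓ heq μ + ℓ * Cummins.kappa μ := by
    have : 0 < Cummins.kappa μ ^ 2 := by positivity
    have : 0 < ℓ * Cummins.kappa μ := by positivity
    linarith
  refine ⟨?_, ?_⟩
  -- For ν = 1/κ the added mass ℓκ cancels exactly, leaving τ_μ²/κ².
  · have hA : 1 < (Cummins.tauSq τbuoy ℓ heq μ + ℓ * Cummins.kappa μ) *
        (1 / Cummins.kappa μ) ^ 2 - ℓ * (1 / Cummins.kappa μ) := by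
      have : (Cummins.tauSq τbuoy ℓ heq μ + ℓ * Cummins.kappa μ) *
          (1 / Cummins.kappa μ) ^ 2 - ℓ * (1 / Cummins.kappa μ) =
          Cummins.tauSq τbuoy ℓ heq μ / Cummins.kappa μ ^ 2 := by
        field_simp; ring
      rw [this, one_lt_div (by positivity)]
      exact hτμ
    obtain ⟨y, h01, h12, hc, heqn, hy0, hy1, hb, htb, hn⟩ :=
      Cummins.exists_dispersive (one_div_pos.2 hκ) hℓ hA δ₀
    obtain ⟨hC2, d0, d1, d2⟩ := Cummins.timeDeriv_of_hasDerivAt h01 h12 (hc 2)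
    have hsol : Cummins.IsDispersiveSolution τbuoy ℓ heq μ δ₀ (y 0) := by
      refine ⟨hC2, fun t ht => ?_, hy0, by rw [d1 0 le_rfl, hy1]⟩
      rw [d2 t ht, ← heqn t ht, Cummins.causalConv_kernelK1]
      congr 3
      refine intervalIntegral.integral_congr fun u hu => ?_
      rw [uIcc_of_le ht] at hu
      simp only [d1 u hu.1]
    have htop : ∀ i, MemLp (y i) ∞ (volume.restrict (Ioi 0)) := fun i => by
      obtain ⟨C, hC⟩ := hb i
      exact memLp_top_of_bound (hc i).aestronglyMeasurable C (ae_of_all _ hC)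
    have hd : ∀ k ≤ 2, ∃ i : Fin 3, ∀ t, 0 ≤ t → Cummins.timeDeriv k (y 0) t = y i t := by
      intro k hk
      interval_cases k
      exacts [⟨0, d0⟩, ⟨1, d1⟩, ⟨2, d2⟩]
    refine ⟨y 0, ⟨hsol, fun k hk => Cummins.memSobolev_of_hasDerivAt h01 h12 hc htop k
      (hk.trans one_le_two)⟩, fun δ' h' _ => Cummins.dispersive_unique hA0 hℓ hsol h',
      Cummins.memSobolev_of_hasDerivAt h01 h12 hc fun i =>
        (Cummins.memLp_two_of_decay (hc i) (hb i) (htb i)).restrict _, fun hδ k hk => ?_⟩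
    obtain ⟨i, hi⟩ := hd k hk
    have hnot := hn hδ i
    refine ⟨fun h => hnot ?_, fun α hα c _ T hT => ?_, fun r hr c _ T hT => ?_⟩
    · refine (memLp_congr_ae ?_).1 h
      filter_upwards [ae_restrict_mem measurableSet_Ioi] with t ht
      rw [hi t (le_of_lt ht)]
    · obtain ⟨t, ht, hlt⟩ := Cummins.exists_gt_of_not_memLp (c := c) (hc i) hnot hα hT
      exact ⟨t, ht, by rwa [hi t (hT.trans ht).le]⟩
    · obtain ⟨t, ht, hlt⟩ := Cummins.exists_gt_exp_of_not_memLp (c := c) (hc i) hnot hr hT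
      exact ⟨t, ht, by rwa [hi t (hT.trans ht).le]⟩
  · obtain ⟨y, y₁, y₂, h01, h12, hc, heqn, hy0, hy1, r, hr, C, hC, hbd⟩ :=
      Cummins.exists_damped_oscillator hτ₀ hℓ δ₀
    obtain ⟨hC2, d0, d1, d2⟩ := Cummins.timeDeriv_of_hasDerivAt h01 h12 hc
    have hsol : Cummins.IsNonDispersiveSolution τbuoy ℓ heq δ₀ y :=
      ⟨hC2, fun t ht => by rw [d1 t ht, d2 t ht, heqn t], hy0, by rw [d1 0 le_rfl, hy1]⟩
    refine ⟨y, hsol, fun η' h' => Cummins.nonDispersive_unique hτ₀ hℓ hsol h',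
      r, hr, C, hC, fun k hk t ht => ?_⟩
    obtain ⟨b0, b1, b2⟩ := hbd t ht
    interval_cases k
    · rwa [d0 t ht]
    · rwa [d1 t ht]
    · rwa [d2 t ht]
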